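/- Let $n\ge 3$, let $\zeta_n\in\mathbb{C}$ be a primitive $n$-th root of unity, $\mathcal{O}_n=\mathbb{Z}[\zeta_n]$ and $\phi$ Euler's function, and identify the plane with $\mathbb{C}$. Let $o_1,\dots,o_m\in\mathcal{O}_n\setminus\{0\}$, $m\ge 2$, be pairwise non-parallel. All of these are fixed, i.e. not part of the input. (a) For all $q_0,\dots,q_{\phi(n)-1}\in\mathbb{Q}$ one has $q_0+q_1\zeta_n+\dots+q_{\phi(n)-1}\zeta_n^{\phi(n)-1}\in\mathcal{O}_n$ if and only if $q_0,\dots,q_{\phi(n)-1}\in\mathbb{Z}$. (b) There are a real RAM program and a constant $C$, depending only on the fixed data, such that the following holds. Let $p_1,\dots,p_m$ be functions, where $p_i$ assigns a non-negative integer to every line of the plane parallel to $o_i$, has finite support, and vanishes outside the module lines $t+\mathbb{R}o_i$, $t\in\mathcal{O}_n$. Suppose that, for each $i$, the lines of $\operatorname{supp}(p_i)$ are given, each once and in any order, as $t+\mathbb{R}o_i$ with $t\in\mathcal{O}_n$ given by its integer coordinates with respect to $1,\zeta_n,\dots,\zeta_n^{\phi(n)-1}$, together with the values of $p_i$ on them.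 Then the program halts after at most $C\,(s^2+1)$ steps, where $s=\max_i\operatorname{card}(\operatorname{supp}(p_i))$, and outputs the partition of the grid $$G=\bigcap_{i=1}^m\ \bigcup_{\ell\in\operatorname{supp}(p_i)}\ell$$ into its equivalence classes for the relation $x\sim y:\Leftrightarrow x-y\in\mathcal{O}_n$: it lists every class once and, for each class, every point once, by its rational coordinates with respect to $1,\zeta_n,\dots,\zeta_n^{\phi(n)-1}$. Here a real RAM is a random access machine whose storage locations hold real numbers, with unit cost for each instruction: $+,-,\times,/$, rational constants, the comparison $<$ of two reals, the test whether a real is an integer, indirect addressing, (conditional) jumps, and reading or writing one real. -/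

import Mathlib

/-! ### The real RAM

A random access machine whose storage locations `0, 1, 2, …` hold one real number each.  It has
the four arithmetic operations, rational program constants, order comparison, the test whether
a register holds an integer, and indirect addressing.  Its input is read from an input tape, its
output is written to an output tape.  Each executed instruction has unit cost. -/

namespace RealRAM

/-- The instructions; `d`, `a`, `b` are register numbers, `l` is a position in the program. -/
inductive Instr where
  /-- `r[d] := q` -/
  | const (d : ℕ) (q : ℚ)
  /-- `r[d] := r[a]` -/
  | copy (d a : ℕ)
  /-- `r[d] := r[a] + r[b]` -/
  | add (d a b : ℕ)
  /-- `r[d] := r[a] - r[b]` -/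
  | sub (d a b : ℕ)
  /-- `r[d] := r[a] * r[b]` -/
  | mul (d a b : ℕ)
  /-- `r[d] := r[a] / r[b]`; the machine crashes if `r[b] = 0` -/
  | div (d a b : ℕ)
  /-- `r[d] := r[r[a]]`; the machine crashes if `r[a]` is not a natural number -/
  | load (d a : ℕ)
  /-- `r[r[a]] := r[b]`; the machine crashes if `r[a]` is not a natural number -/
  | store (a b : ℕ)
  /-- `goto l` -/
  | jump (l : ℕ)
  /-- `if r[a] < r[b] then goto l` -/
  | jumpLt (a b l : ℕ)
  /-- `if r[a]` is an integer `then goto l` -/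
  | jumpInt (a l : ℕ)
  /-- read the next real from the input tape into `r[d]`; crash if there is none -/
  | read (d : ℕ)
  /-- append `r[a]` to the output tape -/
  | write (a : ℕ)
  /-- stop -/
  | halt

/-- A program is a finite list of instructions. -/
abbrev Program := List Instr

/-- A configuration: program counter, memory, unread input, output written so far. -/
structure Config where
  pc : ℕ
  mem : ℕ → ℝ
  input : List ℝ
  output : List ℝ

/-- Start at instruction `0` with all registers `0`. -/
def Config.init (input : List ℝ) : Config where
  pc := 0
  mem := fun _ => 0
  input := input
  output := []

/-- Assign `x` to register `d` and go on with the next instruction. -/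
def Config.assign (c : Config) (d : ℕ) (x : ℝ) : Config :=
  { c with pc := c.pc + 1, mem := Function.update c.mem d x }

open Classical in
/-- The address denoted by a real number, if it is a natural number. -/
noncomputable def address (x : ℝ) : Option ℕ :=
  if x = (⌊x⌋₊ : ℝ) then some ⌊x⌋₊ else none

open Classical in
/-- The effect of one instruction; `none` for `halt` and for a crash. -/
noncomputable def exec (c : Config) : Instr → Option Config
  | .const d q => some (c.assign d (q : ℝ))
  | .copy d a => some (c.assign d (c.mem a))
  | .add d a b => some (c.assign d (c.mem a + c.mem b))
  | .sub d a b => some (c.assign d (c.mem a - c.mem b))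
  | .mul d a b => some (c.assign d (c.mem a * c.mem b))
  | .div d a b => if c.mem b = 0 then none else some (c.assign d (c.mem a / c.mem b))
  | .load d a => (address (c.mem a)).map fun k => c.assign d (c.mem k)
  | .store a b => (address (c.mem a)).map fun k => c.assign k (c.mem b)
  | .jump l => some { c with pc := l }
  | .jumpLt a b l => some { c with pc := if c.mem a < c.mem b then l else c.pc + 1 }
  | .jumpInt a l => some { c with pc := if ∃ z : ℤ, c.mem a = (z : ℝ) then l else c.pc + 1 }
  | .read d =>
    match c.input with
    | [] => none
    | x :: rest => some { (c.assign d x) with input := rest }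
  | .write a => some { c with pc := c.pc + 1, output := c.output ++ [c.mem a] }
  | .halt => none

/-- One step of program `P`. -/
noncomputable def step (P : Program) (c : Config) : Option Config :=
  P[c.pc]?.bind (exec c)

/-- `Reaches P c t c'`: program `P` leads from `c` to `c'` in exactly `t` steps. -/
inductive Reaches (P : Program) : Config → ℕ → Config → Prop where
  | refl (c : Config) : Reaches P c 0 c
  | next {c c' c'' : Config} {t : ℕ} (h : step P c = some c') (h' : Reaches P c' t c'') :
      Reaches P c (t + 1) c''

/-- On the given input, `P` arrives at a `halt` instruction after exactly `t` executed
instructions, having written `output`. -/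
def HaltsWith (P : Program) (input : List ℝ) (t : ℕ) (output : List ℝ) : Prop :=
  ∃ c : Config, Reaches P (Config.init input) t c ∧ P[c.pc]? = some Instr.halt ∧ c.output = output

end RealRAM

/-! ### Cyclotomic grids -/

namespace CycloTomo

/-- `O_n = ℤ[ζ]`, the smallest subring of `ℂ` containing `ζ`. -/
noncomputable def moduleO (ζ : ℂ) : Subalgebra ℤ ℂ := Algebra.adjoin ℤ {ζ}

/-- The number `q₀ + q₁ ζ + ⋯ + q_{φ(n)-1} ζ^{φ(n)-1}`. -/
noncomputable def ofCoords {n : ℕ} (ζ : ℂ) (q : Fin (Nat.totient n) → ℚ) : ℂ :=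
  ∑ k, (q k : ℂ) * ζ ^ (k : ℕ)

/-- The line `t + ℝ o` in the plane `ℂ`. -/
def lineSet (t o : ℂ) : Set ℂ := {z | ∃ r : ℝ, z = t + (r : ℂ) * o}

/-- The set of lines in direction `o`, as a type. -/
def Line (o : ℂ) : Type := {ℓ : Set ℂ // ∃ t : ℂ, ℓ = lineSet t o}

/-- The line in direction `o` through `t`. -/
def Line.through (o t : ℂ) : Line o := ⟨lineSet t o, t, rfl⟩

/-- The module lines in direction `o`: those through a point of `ℤ[ζ]`. -/
def moduleLines (ζ o : ℂ) : Set (Line o) := {ℓ | ∃ t ∈ moduleO ζ, ℓ = Line.through o t}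

/-- The grid of the data `p`: the points which lie, for every `i`, on a line of the support of
`p i`. -/
def grid {m : ℕ} {o : Fin m → ℂ} (p : (i : Fin m) → Line (o i) → ℕ) : Set ℂ :=
  ⋂ i, ⋃ ℓ ∈ Function.support (p i), ℓ.1

/-- Equivalence modulo `ℤ[ζ]`. -/
def ModEquiv (ζ x y : ℂ) : Prop := x - y ∈ moduleO ζ

/-- The equivalence classes modulo `ℤ[ζ]` in a set `G`. -/
def classesIn (ζ : ℂ) (G : Set ℂ) : Set (Set ℂ) :=
  {A | ∃ x ∈ G, A = {y | y ∈ G ∧ ModEquiv ζ x y}}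

/-- The largest cardinality of a support. -/
noncomputable def maxSupport {m : ℕ} {o : Fin m → ℂ} (p : (i : Fin m) → Line (o i) → ℕ) : ℕ :=
  Finset.univ.sup fun i => (Function.support (p i)).ncard

/-- A line `t + ℝ o` with its value: the integer coordinates of `t ∈ ℤ[ζ]`, and the value. -/
abbrev Entry (n : ℕ) : Type := (Fin (Nat.totient n) → ℤ) × ℕ

/-- The line of an entry. -/
noncomputable def Entry.line {n : ℕ} (ζ o : ℂ) (e : Entry n) : Line o :=
  Line.through o (ofCoords ζ fun k => (e.1 k : ℚ))

/-- `L` lists the lines of the support of `p`, each exactly once, with their values. -/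
def Represents {n : ℕ} (ζ : ℂ) {o : ℂ} (p : Line o → ℕ) (L : List (Entry n)) : Prop :=
  (L.map (Entry.line ζ o)).Nodup ∧ (∀ e ∈ L, p (Entry.line ζ o e) = e.2) ∧
    ∀ ℓ, ℓ ∈ Function.support p ↔ ∃ e ∈ L, Entry.line ζ o e = ℓ

/-- The input tape: for each direction in turn the number of lines, followed for each line by its
`φ(n)` coordinates and its value. -/
def encodeInput {n m : ℕ} (L : Fin m → List (Entry n)) : List ℝ :=
  (List.ofFn fun i =>
    ((L i).length : ℝ) :: (L i).flatMap fun e => List.ofFn (fun k => (e.1 k : ℝ)) ++ [(e.2 : ℝ)]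
  ).flatten

/-- The output tape for a list of lists of points, given by their rational coordinates: the number
of lists, followed for each list by its length and the `φ(n)` coordinates of each of its points. -/
def encodeOutput {n : ℕ} (Q : List (List (Fin (Nat.totient n) → ℚ))) : List ℝ :=
  (Q.length : ℝ) :: Q.flatMap fun l =>
    (l.length : ℝ) :: l.flatMap fun q => List.ofFn fun k => (q k : ℝ)

/-- The set of points of a list of coordinate vectors. -/
noncomputable def pointSet {n : ℕ} (ζ : ℂ) (l : List (Fin (Nat.totient n) → ℚ)) : Set ℂ :=
  {z | ∃ q ∈ l, ofCoords ζ q = z}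

/-- `Q` lists the members of the family `𝒜` of sets, each exactly once, and for each member it
lists all its points, each exactly once. -/
def ListsFamily {n : ℕ} (ζ : ℂ) (𝒜 : Set (Set ℂ))
    (Q : List (List (Fin (Nat.totient n) → ℚ))) : Prop :=
  (∀ l ∈ Q, l.Nodup) ∧ (Q.map (pointSet ζ)).Nodup ∧ ∀ A, A ∈ 𝒜 ↔ A ∈ Q.map (pointSet ζ)

end CycloTomo

/-! Statement (a) says that the powers of ζ below φ(n) are independent over ℚ and span ℤ[ζ] over ℤ.
Independence holds because the minimal polynomial of ζ is the cyclotomic polynomial, of degree φ(n);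
the span is everything by division with remainder by this monic integer polynomial.

For (b), the lines parallel to o are the fibres of λ_o(z) = z·conj(o) − conj(z)·o, which is additive
and maps ℤ[ζ] to itself, since ℤ[ζ] is closed under conjugation. In coordinates it is an integer
matrix. Every grid point lies on a line of each of two fixed directions o₀, o₁, so there are at most
s² candidates. By Cramer's rule their denominator is D = λ_{o₀}(o₁) ≠ 0. As D is an algebraic
integer, D·E = N for some E in ℤ[ζ] and some positive integer N, so all candidates lie in (1/N)ℤ[ζ]
and N times a candidate has coordinates that are integer linear in the input (`exists_models`).

Whether a candidate lies on a listed line of another direction is decided in constant time by table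
lookup: the address is an injective polynomial function of the coordinates of λ, and unused memory
is zero. Classes modulo ℤ[ζ] correspond to coordinate vectors modulo N, a number of cases depending
only on the fixed data. For each residue all pairs of lines are scanned and the integrality test
selects the members; the total cost is O(s² + 1). Distinct pairs of lines meet in distinct points,
so nothing is listed twice (`listsFamily`).

The machine program is compiled from a small imperative language. One theorem, `wp_sound`, turns a
weakest precondition with bounded loops into a halting run of bounded length, so that correctness
(`wp_program`) and cost (`costBound_program`) can be treated separately. -/

namespace RealRAM

/-! ### A structured language on top of the real RAM

Programs of the language work on integer variables and on an integer-valued store addressed by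
lists of integers.  Variables, temporaries and store cells occupy the registers with residue
`0`, `1` and `2` modulo `3`. -/

/-- An injective polynomial coding of lists of integers by natural numbers. -/
def code : List ℤ → ℕ
  | [] => 0
  | a :: l => ((2 * a * a + a).toNat + code l) ^ 2 + (2 * a * a + a).toNat + 1

theorem two_mul_sq_add_nonneg (a : ℤ) : 0 ≤ 2 * a * a + a := by
  rcases le_or_gt 0 a with h | h
  · positivity
  · nlinarith

/-- In the factorisation of the difference the second factor is odd, hence nonzero. A polynomial
injection of ℤ into ℕ is needed because addresses are computed by ring operations alone. -/
theorem two_mul_sq_add_inj {a b : ℤ} (h : 2 * a * a + a = 2 * b * b + b) : a = b := by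
  have h1 : (a - b) * (2 * (a + b) + 1) = 0 := by linear_combination h
  rcases mul_eq_zero.1 h1 with h2 | h2 <;> omega

/-- The number lies between (u + v)² and (u + v + 1)², so it determines u + v as its integer square
root. -/
theorem sq_add_inj {u v u' v' : ℕ} (h : (u + v) ^ 2 + u = (u' + v') ^ 2 + u') :
    u = u' ∧ v = v' := by
  have h1 : u + v = u' + v' := by
    rcases lt_trichotomy (u + v) (u' + v') with h2 | h2 | h2
    · nlinarith
    · exact h2
    · nlinarith
  rw [h1] at h
  omega

/-- The final `+ 1` in the code separates nonempty lists from the empty one; peeling off heads then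
distinguishes lists of different lengths too. -/
theorem code_injective : Function.Injective code := by
  intro l
  induction l with
  | nil =>
    rintro (_ | ⟨b, l'⟩) h
    · rfl
    · simp [code] at h
  | cons a l ih =>
    rintro (_ | ⟨b, l'⟩) h
    · simp [code] at h
    · obtain ⟨h1, h2⟩ := sq_add_inj (Nat.succ.inj h)
      have ha := two_mul_sq_add_nonneg a
      have hb := two_mul_sq_add_nonneg b
      rw [ih h2, two_mul_sq_add_inj (a := a) (b := b) (by omega)]

/-- Variables are named by pairs of natural numbers. -/
abbrev Var : Type := ℕ × ℕ

/-- Integer polynomials in the variables. -/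
inductive PolyExpr where
  | const (z : ℤ)
  | var (v : Var)
  | plus (e f : PolyExpr)
  | times (e f : PolyExpr)

namespace PolyExpr

/-- The value of a polynomial expression. -/
def eval (x : Var → ℤ) : PolyExpr → ℤ
  | const z => z
  | var v => x v
  | plus e f => e.eval x + f.eval x
  | times e f => e.eval x * f.eval x

/-- The expression computing the code of a list. -/
def ofList : List PolyExpr → PolyExpr
  | [] => const 0
  | e :: l =>
    let u := plus (times (times (const 2) e) e) e
    let s := plus u (ofList l)
    plus (plus (times s s) u) (const 1)

theorem eval_ofList (x : Var → ℤ) (l : List PolyExpr) :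
    (ofList l).eval x = code (l.map (eval x)) := by
  induction l with
  | nil => rfl
  | cons e l ih =>
    simp only [ofList, eval, ih, List.map_cons, code]
    push_cast
    rw [Int.toNat_of_nonneg (two_mul_sq_add_nonneg _)]
    ring

/-- The sum of a list of expressions. -/
def sum : List PolyExpr → PolyExpr
  | [] => const 0
  | e :: l => plus e (sum l)

theorem eval_sum (x : Var → ℤ) (l : List PolyExpr) : (sum l).eval x = (l.map (eval x)).sum := by
  induction l with
  | nil => rfl
  | cons e l ih => simp [sum, eval, ih]

end PolyExpr

/-! ### Register layout and compilation of polynomial expressions -/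

/-- The register of a variable. -/
def varReg (v : Var) : ℕ := 3 * Nat.pair v.1 v.2

/-- The registers for temporaries. -/
def tmpReg (t : ℕ) : ℕ := 3 * t + 1

/-- The register of a store cell. -/
def cellReg (a : List ℤ) : ℕ := 3 * code a + 2

theorem varReg_inj {v w : Var} : varReg v = varReg w ↔ v = w := by
  refine ⟨fun h => ?_, fun h => h ▸ rfl⟩
  have h1 : Nat.pair v.1 v.2 = Nat.pair w.1 w.2 := by unfold varReg at h; omega
  rw [Nat.pair_eq_pair] at h1
  exact Prod.ext h1.1 h1.2

theorem cellReg_inj {a b : List ℤ} : cellReg a = cellReg b ↔ a = b := by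
  refine ⟨fun h => code_injective ?_, fun h => h ▸ rfl⟩
  unfold cellReg at h
  omega

theorem varReg_ne_tmpReg (v : Var) (t : ℕ) : varReg v ≠ tmpReg t := by
  unfold varReg tmpReg; omega

theorem cellReg_ne_tmpReg (a : List ℤ) (t : ℕ) : cellReg a ≠ tmpReg t := by
  unfold cellReg tmpReg; omega

theorem varReg_ne_cellReg (v : Var) (a : List ℤ) : varReg v ≠ cellReg a := by
  unfold varReg cellReg; omega

theorem tmpReg_ne_tmpReg {s t : ℕ} (h : s ≠ t) : tmpReg s ≠ tmpReg t := by
  unfold tmpReg; omega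

/-- The program evaluating an expression into the temporary `t`, using temporaries from `t` on. -/
def PolyExpr.compile : PolyExpr → ℕ → Program
  | const z, t => [.const (tmpReg t) z]
  | var v, t => [.copy (tmpReg t) (varReg v)]
  | plus e f, t =>
    e.compile t ++ (f.compile (t + 1) ++ [.add (tmpReg t) (tmpReg t) (tmpReg (t + 1))])
  | times e f, t =>
    e.compile t ++ (f.compile (t + 1) ++ [.mul (tmpReg t) (tmpReg t) (tmpReg (t + 1))])

/-- The expression for the register of a store cell. -/
def cellExpr (es : List PolyExpr) : PolyExpr :=
  .plus (.times (.const 3) (.ofList es)) (.const 2)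

theorem eval_cellExpr (x : Var → ℤ) (es : List PolyExpr) :
    (cellExpr es).eval x = cellReg (es.map (PolyExpr.eval x)) := by
  simp [cellExpr, PolyExpr.eval, PolyExpr.eval_ofList, cellReg]

/-- Program `B` is found in `P` at position `pc`. -/
def CodeAt (P : Program) (pc : ℕ) (B : Program) : Prop :=
  ∃ pre suf, P = pre ++ B ++ suf ∧ pre.length = pc

theorem CodeAt.left {P : Program} {pc : ℕ} {A B : Program} (h : CodeAt P pc (A ++ B)) :
    CodeAt P pc A := by
  obtain ⟨pre, suf, rfl, h⟩ := h
  exact ⟨pre, B ++ suf, by simp, h⟩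

theorem CodeAt.right {P : Program} {pc : ℕ} {A B : Program} (h : CodeAt P pc (A ++ B)) :
    CodeAt P (pc + A.length) B := by
  obtain ⟨pre, suf, rfl, h⟩ := h
  exact ⟨pre ++ A, suf, by simp, by simp [h]⟩

theorem CodeAt.head {P : Program} {pc : ℕ} {i : Instr} {B : Program} (h : CodeAt P pc (i :: B)) :
    P[pc]? = some i := by
  obtain ⟨pre, suf, rfl, rfl⟩ := h
  simp

theorem CodeAt.tail {P : Program} {pc : ℕ} {i : Instr} {B : Program} (h : CodeAt P pc (i :: B)) :
    CodeAt P (pc + 1) B :=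
  CodeAt.right (A := [i]) h

theorem Reaches.trans {P : Program} {c c' c'' : Config} {t t' : ℕ} (h : Reaches P c t c')
    (h' : Reaches P c' t' c'') : Reaches P c (t + t') c'' := by
  induction h with
  | refl c => simpa using h'
  | next h1 _ ih =>
    rw [Nat.add_right_comm]
    exact .next h1 (ih h')

theorem Reaches.single {P : Program} {c c' : Config} {i : Instr} (h : P[c.pc]? = some i)
    (h' : exec c i = some c') : Reaches P c 1 c' :=
  .next (by simp [step, h, h']) (.refl c')

theorem address_natCast (k : ℕ) : address (k : ℝ) = some k := by
  simp [address]

/-- Temporaries serve as a stack: the second operand is evaluated from `t + 1` on, so the first one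
survives in `t`. The code has no jumps, hence its running time is its length. -/
theorem reaches_compile {P : Program} {x : Var → ℤ} (e : PolyExpr) :
    ∀ (t : ℕ) (c : Config), CodeAt P c.pc (e.compile t) → (∀ v, c.mem (varReg v) = x v) →
      ∃ M, Reaches P c (e.compile t).length
          { c with pc := c.pc + (e.compile t).length, mem := M } ∧
        M (tmpReg t) = e.eval x ∧ ∀ a, (∀ j, t ≤ j → a ≠ tmpReg j) → M a = c.mem a := by
  have binary : ∀ (e f : PolyExpr) (i : ℕ → Instr) (op : ℝ → ℝ → ℝ)
      (_ : ∀ t c, exec c (i t) =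
        some (c.assign (tmpReg t) (op (c.mem (tmpReg t)) (c.mem (tmpReg (t + 1))))))
      (_ : ∀ (t : ℕ) (c : Config), CodeAt P c.pc (e.compile t) → (∀ v, c.mem (varReg v) = x v) →
      ∃ M, Reaches P c (e.compile t).length
          { c with pc := c.pc + (e.compile t).length, mem := M } ∧
        M (tmpReg t) = e.eval x ∧ ∀ a, (∀ j, t ≤ j → a ≠ tmpReg j) → M a = c.mem a)
      (_ : ∀ (t : ℕ) (c : Config), CodeAt P c.pc (f.compile t) → (∀ v, c.mem (varReg v) = x v) →
      ∃ M, Reaches P c (f.compile t).length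
          { c with pc := c.pc + (f.compile t).length, mem := M } ∧
        M (tmpReg t) = f.eval x ∧ ∀ a, (∀ j, t ≤ j → a ≠ tmpReg j) → M a = c.mem a)
      (t : ℕ) (c : Config), CodeAt P c.pc (e.compile t ++ (f.compile (t + 1) ++ [i t])) →
      (∀ v, c.mem (varReg v) = x v) →
      ∃ M, Reaches P c (e.compile t ++ (f.compile (t + 1) ++ [i t])).length
          { c with pc := c.pc + (e.compile t ++ (f.compile (t + 1) ++ [i t])).length, mem := M } ∧
        M (tmpReg t) = op (e.eval x) (f.eval x) ∧
          ∀ a, (∀ j, t ≤ j → a ≠ tmpReg j) → M a = c.mem a := by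
    intro e f i op hi he hf t c hc hx
    obtain ⟨M, h1, h2, h3⟩ := he t c hc.left hx
    obtain ⟨M', h4, h5, h6⟩ := hf (t + 1)
      { c with pc := c.pc + (e.compile t).length, mem := M } hc.right.left
      fun v => by rw [← hx v]; exact h3 _ fun j _ => varReg_ne_tmpReg v j
    refine ⟨Function.update M' (tmpReg t) (op (M' (tmpReg t)) (M' (tmpReg (t + 1)))), ?_, ?_, ?_⟩
    · have h7 := (h1.trans h4).trans (Reaches.single hc.right.right.head (hi t _))
      simpa [Config.assign, add_assoc] using h7
    · rw [Function.update_self, h5, h6 _ fun j hj => tmpReg_ne_tmpReg (by omega)]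
      simp only [h2]
    · intro a ha
      rw [Function.update_of_ne (ha t le_rfl), h6 a fun j hj => ha j (by omega)]
      exact h3 a ha
  induction e with
  | const z =>
    intro t c hc hx
    refine ⟨Function.update c.mem (tmpReg t) z, ?_, by simp [PolyExpr.eval], fun a ha =>
      Function.update_of_ne (ha t le_rfl) _ _⟩
    exact Reaches.single hc.head (by simp [exec, Config.assign, PolyExpr.compile])
  | var v =>
    intro t c hc hx
    refine ⟨Function.update c.mem (tmpReg t) (x v), ?_, by simp [PolyExpr.eval], fun a ha =>
      Function.update_of_ne (ha t le_rfl) _ _⟩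
    exact Reaches.single hc.head (by simp [exec, Config.assign, PolyExpr.compile, hx])
  | plus e f ihe ihf =>
    intro t c hc hx
    simpa [PolyExpr.eval, PolyExpr.compile] using
      binary e f (fun t => .add (tmpReg t) (tmpReg t) (tmpReg (t + 1))) (· + ·)
        (fun _ _ => rfl) ihe ihf t c hc hx
  | times e f ihe ihf =>
    intro t c hc hx
    simpa [PolyExpr.eval, PolyExpr.compile] using
      binary e f (fun t => .mul (tmpReg t) (tmpReg t) (tmpReg (t + 1))) (· * ·)
        (fun _ _ => rfl) ihe ihf t c hc hx

/-! ### States, guards and their representation in memory -/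

/-- A state of the structured language. -/
structure State where
  vars : Var → ℤ
  store : List ℤ → ℤ
  input : List ℤ
  output : List ℚ

/-- Assignment to a variable. -/
def State.set (σ : State) (v : Var) (z : ℤ) : State :=
  { σ with vars := Function.update σ.vars v z }

/-- The configuration `c` represents the state `σ`. -/
structure Represented (σ : State) (c : Config) : Prop where
  vars : ∀ v, c.mem (varReg v) = σ.vars v
  store : ∀ a, c.mem (cellReg a) = σ.store a
  input : c.input = σ.input.map (fun z : ℤ => (z : ℝ))
  output : c.output = σ.output.map (fun q : ℚ => (q : ℝ))

/-- Conditions for branching. -/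
inductive Guard where
  /-- `e < f` -/
  | lt (e f : PolyExpr)
  /-- `q * e` is an integer -/
  | int (e : PolyExpr) (q : ℚ)
  /-- the store cell `es` holds a positive number -/
  | pos (es : List PolyExpr)

/-- The truth value of a guard. -/
def Guard.Holds (σ : State) : Guard → Prop
  | lt e f => e.eval σ.vars < f.eval σ.vars
  | int e q => ∃ z : ℤ, (e.eval σ.vars : ℚ) * q = z
  | pos es => 0 < σ.store (es.map (PolyExpr.eval σ.vars))

/-- The instructions preparing the branch of a guard. -/
def Guard.prepare : Guard → Program
  | lt e f => e.compile 0 ++ f.compile 1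
  | int e q => e.compile 0 ++ [.const (tmpReg 1) q, .mul (tmpReg 0) (tmpReg 0) (tmpReg 1)]
  | pos es => (cellExpr es).compile 0 ++ [.load (tmpReg 1) (tmpReg 0), .const (tmpReg 0) 0]

/-- The branch instruction of a guard. -/
def Guard.branch : Guard → ℕ → Instr
  | lt _ _, l => .jumpLt (tmpReg 0) (tmpReg 1) l
  | int _ _, l => .jumpInt (tmpReg 0) l
  | pos _, l => .jumpLt (tmpReg 0) (tmpReg 1) l

/-- Temporaries belong to no variable or cell, so they may hold arbitrary reals, in particular the
fractions arising in integrality tests. -/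
theorem Represented.of_agree {σ : State} {c : Config} (h : Represented σ c) (pc : ℕ) {M : ℕ → ℝ}
    (hM : ∀ a, (∀ j, a ≠ tmpReg j) → M a = c.mem a) :
    Represented σ { c with pc := pc, mem := M } where
  vars v := (hM _ (varReg_ne_tmpReg v)).trans (h.vars v)
  store a := (hM _ (cellReg_ne_tmpReg a)).trans (h.store a)
  input := h.input
  output := h.output

theorem Represented.compile {P : Program} {σ : State} {c : Config} (h : Represented σ c)
    (e : PolyExpr) (t : ℕ) (hc : CodeAt P c.pc (e.compile t)) :
    ∃ c', Reaches P c (e.compile t).length c' ∧ c'.pc = c.pc + (e.compile t).length ∧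
      Represented σ c' ∧ c'.mem (tmpReg t) = e.eval σ.vars ∧
      ∀ j < t, c'.mem (tmpReg j) = c.mem (tmpReg j) := by
  obtain ⟨M, h1, h2, h3⟩ := reaches_compile e t c hc h.vars
  exact ⟨_, h1, rfl, h.of_agree _ fun a ha => h3 a fun j _ => ha j, h2,
    fun j hj => h3 _ fun i hi => tmpReg_ne_tmpReg (by omega)⟩

theorem Represented.assign_tmp {σ : State} {c : Config} (h : Represented σ c) (t : ℕ) (r : ℝ) :
    Represented σ (c.assign (tmpReg t) r) :=
  h.of_agree _ fun _ ha => Function.update_of_ne (ha t) _ _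

theorem Represented.pc {σ : State} {c : Config} (h : Represented σ c) (l : ℕ) :
    Represented σ { c with pc := l } :=
  h.of_agree _ fun _ _ => rfl

theorem Represented.assign_var {σ : State} {c : Config} (h : Represented σ c) (v : Var) {r : ℝ}
    {z : ℤ} (hr : r = z) : Represented (σ.set v z) (c.assign (varReg v) r) where
  vars w := by
    by_cases hw : w = v
    · subst hw; simp [Config.assign, State.set, hr]
    · simp [Config.assign, State.set, hw, varReg_inj, h.vars]
  store a := by
    simp [Config.assign, State.set, (varReg_ne_cellReg v a).symm, h.store]
  input := h.input
  output := h.output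

theorem Represented.assign_cell {σ : State} {c : Config} (h : Represented σ c) (a : List ℤ) {r : ℝ}
    {z : ℤ} (hr : r = z) :
    Represented { σ with store := Function.update σ.store a z } (c.assign (cellReg a) r) where
  vars w := by
    simp [Config.assign, varReg_ne_cellReg w a, h.vars]
  store b := by
    by_cases hb : b = a
    · subst hb; simp [Config.assign, hr]
    · simp [Config.assign, hb, cellReg_inj, h.store]
  input := h.input
  output := h.output

open Classical in
theorem Represented.guard {P : Program} {σ : State} {c : Config} (h : Represented σ c)
    (g : Guard) (l : ℕ) (hc : CodeAt P c.pc (g.prepare ++ [g.branch l])) :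
    ∃ c', Reaches P c (g.prepare.length + 1) c' ∧
      c'.pc = (if g.Holds σ then l else c.pc + g.prepare.length + 1) ∧ Represented σ c' := by
  cases g with
  | lt e f =>
    obtain ⟨c1, h1, p1, r1, e1, -⟩ := h.compile e 0 hc.left.left
    obtain ⟨c2, h2, p2, r2, e2, k2⟩ := r1.compile f 1 (by rw [p1]; exact hc.left.right)
    have hp : c2.pc = c.pc + (Guard.lt e f).prepare.length := by
      simp [p2, p1, Guard.prepare, add_assoc]
    refine ⟨_, (by simpa [Guard.prepare] using h1.trans h2 : Reaches P c _ c2).trans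
      (Reaches.single (by rw [hp]; exact hc.right.head) rfl), ?_, r2.pc _⟩
    simp only [e2, k2 0 one_pos, e1, Int.cast_lt, Guard.Holds, hp]
    by_cases hh : e.eval σ.vars < f.eval σ.vars <;> simp only [hh, if_true, if_false]
  | int e q =>
    obtain ⟨c1, h1, p1, r1, e1, -⟩ := h.compile e 0 hc.left.left
    have h2 := Reaches.single (P := P) (c := c1) (by rw [p1]; exact hc.left.right.head) rfl
    have h3 := Reaches.single (P := P) (c := c1.assign (tmpReg 1) q)
      (by simp only [Config.assign, p1]; exact hc.left.right.tail.head) rfl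
    set c3 := (c1.assign (tmpReg 1) q).assign (tmpReg 0)
      ((c1.assign (tmpReg 1) q).mem (tmpReg 0) * (c1.assign (tmpReg 1) q).mem (tmpReg 1)) with hc3
    have hp : c3.pc = c.pc + (Guard.int e q).prepare.length := by
      simp [hc3, Config.assign, p1, Guard.prepare, add_assoc]
    have hv : c3.mem (tmpReg 0) = (e.eval σ.vars : ℝ) * q := by
      simp [hc3, Config.assign, Function.update_of_ne (tmpReg_ne_tmpReg zero_ne_one), e1]
    refine ⟨_, (by simpa [Guard.prepare] using (h1.trans h2).trans h3 : Reaches P c _ c3).trans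
      (Reaches.single (by rw [hp]; exact hc.right.head) rfl), ?_,
      ((r1.assign_tmp _ _).assign_tmp _ _).pc _⟩
    have : (∃ z : ℤ, (e.eval σ.vars : ℝ) * q = z) ↔ (Guard.int e q).Holds σ := by
      refine exists_congr fun z => ?_
      exact_mod_cast Iff.rfl
    simp only [hv, this, hp]
  | pos es =>
    obtain ⟨c1, h1, p1, r1, e1, -⟩ := h.compile (cellExpr es) 0 hc.left.left
    rw [eval_cellExpr, Int.cast_natCast] at e1
    have h2 := Reaches.single (P := P) (c := c1)
      (c' := c1.assign (tmpReg 1) (σ.store (es.map (PolyExpr.eval σ.vars))))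
      (by rw [p1]; exact hc.left.right.head) (by simp [exec, e1, address_natCast, r1.store])
    set c2 := c1.assign (tmpReg 1) (σ.store (es.map (PolyExpr.eval σ.vars))) with hc2
    have h3 := Reaches.single (P := P) (c := c2)
      (by simp only [hc2, Config.assign, p1]; exact hc.left.right.tail.head) rfl
    set c3 := c2.assign (tmpReg 0) ((0 : ℚ) : ℝ) with hc3
    have hp : c3.pc = c.pc + (Guard.pos es).prepare.length := by
      simp [hc3, hc2, Config.assign, p1, Guard.prepare, add_assoc]
    have hv : c3.mem (tmpReg 0) = 0 := by simp [hc3, Config.assign]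
    have hw : c3.mem (tmpReg 1) = σ.store (es.map (PolyExpr.eval σ.vars)) := by
      simp [hc3, hc2, Config.assign, Function.update_of_ne (tmpReg_ne_tmpReg one_ne_zero)]
    refine ⟨_, (by simpa [Guard.prepare] using (h1.trans h2).trans h3 : Reaches P c _ c3).trans
      (Reaches.single (by rw [hp]; exact hc.right.head) rfl), ?_,
      ((r1.assign_tmp _ _).assign_tmp _ _).pc _⟩
    simp only [hv, hw, hp, Guard.Holds, Int.cast_pos]
    by_cases hh : 0 < σ.store (es.map (PolyExpr.eval σ.vars)) <;>
      simp only [hh, if_true, if_false]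

/-! ### Statements, weakest preconditions and soundness of the compilation -/

/-- Statements of the structured language. -/
inductive Stmt where
  | skip
  | seq (a b : Stmt)
  | set (v : Var) (e : PolyExpr)
  | load (v : Var) (es : List PolyExpr)
  | store (es : List PolyExpr) (e : PolyExpr)
  | read (v : Var)
  | write (e : PolyExpr) (q : ℚ)
  | cond (g : Guard) (a : Stmt)
  | loop (g : Guard) (a : Stmt)

namespace Stmt

/-- Compilation of a statement to be placed at position `pc`. -/
def compile : Stmt → ℕ → Program
  | skip, _ => []
  | seq a b, pc => a.compile pc ++ b.compile (pc + (a.compile pc).length)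
  | set v e, _ => e.compile 0 ++ [.copy (varReg v) (tmpReg 0)]
  | load v es, _ => (cellExpr es).compile 0 ++ [.load (varReg v) (tmpReg 0)]
  | store es e, _ =>
    (cellExpr es).compile 0 ++ (e.compile 1 ++ [.store (tmpReg 0) (tmpReg 1)])
  | read v, _ => [.read (varReg v)]
  | write e q, _ => e.compile 0 ++
    [.const (tmpReg 1) q, .mul (tmpReg 0) (tmpReg 0) (tmpReg 1), .write (tmpReg 0)]
  | cond g a, pc =>
    let k := pc + g.prepare.length + 2
    let B := a.compile k
    (g.prepare ++ [g.branch k]) ++ (.jump (k + B.length) :: B)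
  | loop g a, pc =>
    let k := pc + g.prepare.length + 2
    let B := a.compile k
    (g.prepare ++ [g.branch k]) ++ (.jump (k + B.length + 1) :: (B ++ [.jump pc]))

/-- The weakest precondition for exactly `n` rounds of a loop. -/
def rounds (g : Guard) (w : (State → Prop) → State → Prop) (Q : State → Prop) : ℕ → State → Prop
  | 0, σ => ¬ g.Holds σ ∧ Q σ
  | n + 1, σ => g.Holds σ ∧ w (rounds g w Q n) σ

open Classical in
/-- The weakest precondition for termination in a state satisfying the postcondition, with at most
`S` rounds in every loop. -/
def wp (S : ℕ) : Stmt → (State → Prop) → State → Prop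
  | skip, Q, σ => Q σ
  | seq a b, Q, σ => a.wp S (b.wp S Q) σ
  | set v e, Q, σ => Q (σ.set v (e.eval σ.vars))
  | load v es, Q, σ => Q (σ.set v (σ.store (es.map (PolyExpr.eval σ.vars))))
  | store es e, Q, σ => Q { σ with
      store := Function.update σ.store (es.map (PolyExpr.eval σ.vars)) (e.eval σ.vars) }
  | read v, Q, σ => ∃ z l, σ.input = z :: l ∧ Q { σ.set v z with input := l }
  | write e q, Q, σ => Q { σ with output := σ.output ++ [(e.eval σ.vars : ℚ) * q] }
  | cond g a, Q, σ => if g.Holds σ then a.wp S Q σ else Q σ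
  | loop g a, Q, σ => ∃ n ≤ S, rounds g (a.wp S) Q n σ

/-- A bound for the number of steps, if no loop makes more than `S` rounds. -/
def cost (S : ℕ) : Stmt → ℕ
  | skip => 0
  | seq a b => a.cost S + b.cost S
  | set _ e => (e.compile 0).length + 1
  | load _ es => ((cellExpr es).compile 0).length + 1
  | store es e => ((cellExpr es).compile 0).length + (e.compile 1).length + 1
  | read _ => 1
  | write e _ => (e.compile 0).length + 3
  | cond g a => g.prepare.length + 2 + a.cost S
  | loop g a => S * (g.prepare.length + 2 + a.cost S) + (g.prepare.length + 2)

/-- Structural induction; a loop needs an inner induction on its number of rounds, each of which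
ends with a jump back to the start of the loop code. Crashes are excluded because store addresses
are codes, hence natural numbers, and no division is ever compiled. -/
theorem wp_sound {P : Program} {S : ℕ} (s : Stmt) : ∀ (c : Config) (σ : State) (Q : State → Prop),
    CodeAt P c.pc (s.compile c.pc) → Represented σ c → s.wp S Q σ →
      ∃ t ≤ s.cost S, ∃ c' σ', Reaches P c t c' ∧ c'.pc = c.pc + (s.compile c.pc).length ∧
        Represented σ' c' ∧ Q σ' := by
  induction s with
  | skip => exact fun c σ Q _ hr h => ⟨0, le_rfl, c, σ, .refl c, rfl, hr, h⟩
  | seq a b iha ihb =>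
    intro c σ Q hc hr h
    obtain ⟨t1, ht1, c1, σ1, h1, p1, r1, w1⟩ := iha c σ _ hc.left hr h
    obtain ⟨t2, ht2, c2, σ2, h2, p2, r2, w2⟩ := ihb c1 σ1 Q (by rw [p1]; exact hc.right) r1 w1
    refine ⟨t1 + t2, add_le_add ht1 ht2, c2, σ2, h1.trans h2, ?_, r2, w2⟩
    rw [p2, p1]
    simp [compile, add_assoc]
  | set v e =>
    intro c σ Q hc hr h
    obtain ⟨c1, h1, p1, r1, e1, -⟩ := hr.compile e 0 hc.left
    refine ⟨_, le_rfl, _, _, h1.trans (Reaches.single (by rw [p1]; exact hc.right.head) rfl), ?_,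
      r1.assign_var v e1, h⟩
    simp [Config.assign, p1, compile, add_assoc]
  | load v es =>
    intro c σ Q hc hr h
    obtain ⟨c1, h1, p1, r1, e1, -⟩ := hr.compile (cellExpr es) 0 hc.left
    rw [eval_cellExpr, Int.cast_natCast] at e1
    refine ⟨_, le_rfl, _, _, h1.trans (Reaches.single (by rw [p1]; exact hc.right.head)
      (by simp [exec, e1, address_natCast])), ?_, r1.assign_var v (r1.store _), h⟩
    simp [Config.assign, p1, compile, add_assoc]
  | store es e =>
    intro c σ Q hc hr h
    obtain ⟨c1, h1, p1, r1, e1, -⟩ := hr.compile (cellExpr es) 0 hc.left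
    obtain ⟨c2, h2, p2, r2, e2, k2⟩ := r1.compile e 1 (by rw [p1]; exact hc.right.left)
    rw [eval_cellExpr, Int.cast_natCast, ← k2 0 one_pos] at e1
    refine ⟨_, le_rfl, _, _, (h1.trans h2).trans (Reaches.single
      (by rw [p2, p1]; exact hc.right.right.head)
      (by simp [exec, e1, address_natCast])), ?_, r2.assign_cell _ e2, h⟩
    simp [Config.assign, p2, p1, compile, add_assoc]
  | read v =>
    intro c σ Q hc hr h
    obtain ⟨z, l, hl, h⟩ := h
    have hi : c.input = (z : ℝ) :: l.map (fun z : ℤ => (z : ℝ)) := by rw [hr.input, hl]; rfl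
    refine ⟨1, le_rfl, _, _, Reaches.single hc.head (by simp only [exec, hi]; rfl), rfl, ?_, h⟩
    have := hr.assign_var v (rfl : (z : ℝ) = z)
    exact ⟨this.vars, this.store, rfl, this.output⟩
  | write e q =>
    intro c σ Q hc hr h
    obtain ⟨c1, h1, p1, r1, e1, -⟩ := hr.compile e 0 hc.left
    have h2 := Reaches.single (P := P) (c := c1) (by rw [p1]; exact hc.right.head) rfl
    have h3 := Reaches.single (P := P) (c := c1.assign (tmpReg 1) q)
      (by simp only [Config.assign, p1]; exact hc.right.tail.head) rfl
    set c3 := (c1.assign (tmpReg 1) q).assign (tmpReg 0)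
      ((c1.assign (tmpReg 1) q).mem (tmpReg 0) * (c1.assign (tmpReg 1) q).mem (tmpReg 1)) with hc3
    have hp : c3.pc = c.pc + (e.compile 0).length + 1 + 1 := by
      simp [hc3, Config.assign, p1]
    have hv : c3.mem (tmpReg 0) = (e.eval σ.vars : ℝ) * q := by
      simp [hc3, Config.assign, Function.update_of_ne (tmpReg_ne_tmpReg zero_ne_one), e1]
    have r3 : Represented σ c3 := (r1.assign_tmp _ _).assign_tmp _ _
    have h4 := Reaches.single (P := P) (c := c3)
      (by rw [hp]; exact hc.right.tail.tail.head) rfl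
    refine ⟨_, le_rfl, _, _, ((h1.trans h2).trans h3).trans h4, ?_, ?_, h⟩
    · simp [hp, compile, add_assoc]
    · exact ⟨r3.vars, r3.store, r3.input, by simp [hv, r3.output]⟩
  | cond g a ih =>
    intro c σ Q hc hr h
    obtain ⟨c1, h1, p1, r1⟩ := hr.guard g _ hc.left
    -- The body comes after the branch and the jump that skips it, which explains the offset 2.
    have hq : c.pc + (g.prepare ++ [g.branch (c.pc + g.prepare.length + 2)]).length + 1
        = c.pc + g.prepare.length + 2 := by simp [add_assoc]
    by_cases hg : g.Holds σ
    · rw [if_pos hg] at p1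
      rw [wp, if_pos hg] at h
      obtain ⟨t2, ht2, c2, σ2, h2, p2, r2, w2⟩ := ih c1 σ Q
        (by have := hc.right.tail; rw [hq] at this; rwa [p1]) r1 h
      refine ⟨_, ?_, c2, σ2, h1.trans h2, ?_, r2, w2⟩
      · simp only [cost]; omega
      · rw [p2, p1]; simp only [compile, List.length_append, List.length_cons, List.length_nil,
          add_assoc]
        omega
    · rw [if_neg hg] at p1
      rw [wp, if_neg hg] at h
      refine ⟨_, ?_, _, σ, h1.trans (Reaches.single (by
        rw [p1]; have := hc.right.head; simpa [add_assoc] using this) rfl), ?_, r1.pc _, h⟩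
      · simp only [cost]; omega
      · simp only [compile, List.length_append, List.length_cons, List.length_nil,
          add_assoc]
        omega
  | loop g a ih =>
    intro c σ Q hc hr h
    obtain ⟨n, hn, h⟩ := h
    -- The bound is proved with the actual number of rounds; the extra summand pays for the last,
    -- failing evaluation of the guard.
    suffices H : ∀ n σ c', c'.pc = c.pc → Represented σ c' → rounds g (a.wp S) Q n σ →
        ∃ t ≤ n * (g.prepare.length + 2 + a.cost S) + (g.prepare.length + 2), ∃ c'' σ',
          Reaches P c' t c'' ∧ c''.pc = c.pc + ((loop g a).compile c.pc).length ∧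
          Represented σ' c'' ∧ Q σ' by
      obtain ⟨t, ht, H⟩ := H n σ c rfl hr h
      exact ⟨t, ht.trans (Nat.add_le_add_right (Nat.mul_le_mul_right _ hn) _), H⟩
    clear h hr hn n σ
    intro n
    have hq : c.pc + (g.prepare ++ [g.branch (c.pc + g.prepare.length + 2)]).length + 1
        = c.pc + g.prepare.length + 2 := by simp [add_assoc]
    induction n with
    | zero =>
      intro σ c' hp hr h
      obtain ⟨c1, h1, p1, r1⟩ := hr.guard g _ (by rw [hp]; exact hc.left)
      rw [if_neg h.1] at p1
      refine ⟨_, ?_, _, σ, h1.trans (Reaches.single (by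
        rw [p1, hp]; have := hc.right.head; simpa [add_assoc] using this) rfl), ?_, r1.pc _, h.2⟩
      · omega
      · simp only [compile, List.length_append, List.length_cons, List.length_nil,
          add_assoc]
        omega
    | succ n ihn =>
      intro σ c' hp hr h
      obtain ⟨c1, h1, p1, r1⟩ := hr.guard g _ (by rw [hp]; exact hc.left)
      rw [if_pos h.1] at p1
      have hB := hc.right.tail
      rw [hq] at hB
      obtain ⟨t2, ht2, c2, σ2, h2, p2, r2, w2⟩ := ih c1 σ _ (by rw [p1]; exact hB.left) r1 h.2
      have h3 := Reaches.single (P := P) (c := c2)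
        (by rw [p2, p1]; exact hB.right.head) rfl
      obtain ⟨t4, ht4, c4, σ4, h4, H⟩ := ihn σ2 { c2 with pc := c.pc } rfl (r2.pc _) w2
      refine ⟨_, ?_, c4, σ4, ((h1.trans h2).trans h3).trans h4, H⟩
      rw [Nat.succ_mul]
      omega

/-! ### Proof rules -/

theorem wp_mono {S : ℕ} (s : Stmt) : ∀ {Q Q' : State → Prop}, (∀ σ, Q σ → Q' σ) → ∀ {σ},
    s.wp S Q σ → s.wp S Q' σ := by
  induction s with
  | skip => exact fun h σ => h σ
  | seq a b iha ihb => exact fun h σ => iha fun _ => ihb h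
  | set v e => exact fun h σ => h _
  | load v es => exact fun h σ => h _
  | store es e => exact fun h σ => h _
  | read v => exact fun h σ ⟨z, l, hl, hQ⟩ => ⟨z, l, hl, h _ hQ⟩
  | write e q => exact fun h σ => h _
  | cond g a ih =>
    intro Q Q' h σ hw
    by_cases hg : g.Holds σ
    · rw [wp, if_pos hg] at hw ⊢; exact ih h hw
    · rw [wp, if_neg hg] at hw ⊢; exact h _ hw
  | loop g a ih =>
    rintro Q Q' h σ ⟨n, hn, hw⟩
    refine ⟨n, hn, ?_⟩
    clear hn
    induction n generalizing σ with
    | zero => exact ⟨hw.1, h _ hw.2⟩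
    | succ n ihn => exact ⟨hw.1, ih (fun _ => ihn) hw.2⟩

/-- A loop running through a list. -/
theorem wp_loop {S : ℕ} {g : Guard} {a : Stmt} {α : Type*} (l : List α) (hS : l.length ≤ S)
    (I : List α → List α → State → Prop) {Q : State → Prop} {σ : State} (h0 : I [] l σ)
    (hstep : ∀ pre x suf, l = pre ++ x :: suf → ∀ σ, I pre (x :: suf) σ →
      g.Holds σ ∧ a.wp S (I (pre ++ [x]) suf) σ)
    (hend : ∀ σ, I l [] σ → ¬ g.Holds σ ∧ Q σ) : (loop g a).wp S Q σ := by
  refine ⟨l.length, hS, ?_⟩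
  suffices H : ∀ suf pre σ, l = pre ++ suf → I pre suf σ → rounds g (a.wp S) Q suf.length σ from
    H l [] σ rfl h0
  intro suf
  induction suf with
  | nil =>
    rintro pre σ rfl h
    rw [List.append_nil] at hend
    exact hend σ h
  | cons x suf ih =>
    intro pre σ hl h
    obtain ⟨h1, h2⟩ := hstep pre x suf hl σ h
    exact ⟨h1, wp_mono a (fun σ' h' => ih (pre ++ [x]) σ' (by simp [hl]) h') h2⟩

/-- A statement repeated for the members of a fixed list. -/
def block {α : Type*} (f : α → Stmt) : List α → Stmt
  | [] => skip
  | x :: l => seq (f x) (block f l)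

/-- The invariant sees the processed prefix and the remaining suffix, as for `wp_loop`; here the
list is part of the program text and not of the input. -/
theorem wp_block {S : ℕ} {α : Type*} {f : α → Stmt} (l : List α)
    (I : List α → List α → State → Prop) {σ : State} (h0 : I [] l σ)
    (hstep : ∀ pre x suf, l = pre ++ x :: suf → ∀ σ, I pre (x :: suf) σ →
      (f x).wp S (I (pre ++ [x]) suf) σ) : (block f l).wp S (I l []) σ := by
  suffices H : ∀ suf pre σ, l = pre ++ suf → I pre suf σ → (block f suf).wp S (I l []) σ from
    H l [] σ rfl h0
  intro suf
  induction suf with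
  | nil =>
    rintro pre σ rfl h
    rw [List.append_nil]
    exact h
  | cons x suf ih =>
    intro pre σ hl h
    exact wp_mono _ (fun σ' h' => ih (pre ++ [x]) σ' (by simp [hl]) h') (hstep pre x suf hl σ h)

/-- A statement executed if all guards of a list hold. -/
def guarded (a : Stmt) : List Guard → Stmt
  | [] => a
  | g :: l => cond g (guarded a l)

theorem wp_guarded {S : ℕ} {a : Stmt} {Q : State → Prop} {σ : State} (l : List Guard)
    (h1 : (∀ g ∈ l, g.Holds σ) → a.wp S Q σ) (h2 : (¬ ∀ g ∈ l, g.Holds σ) → Q σ) :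
    (guarded a l).wp S Q σ := by
  induction l with
  | nil => exact h1 (by simp)
  | cons g l ih =>
    rw [guarded, wp]
    by_cases hg : g.Holds σ
    · rw [if_pos hg]
      exact ih (fun h => h1 (by simpa [hg] using h)) fun h => h2 (by simpa [hg] using h)
    · rw [if_neg hg]
      exact h2 (by simp [hg])

theorem wp_seq {S : ℕ} {a b : Stmt} {R Q : State → Prop} {σ : State} (ha : a.wp S R σ)
    (hb : ∀ σ, R σ → b.wp S Q σ) : (seq a b).wp S Q σ :=
  wp_mono a hb ha

/-! ### Growth of the cost -/

/-- The cost grows at most like `S ^ k`. -/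
def CostBound (s : Stmt) (k : ℕ) : Prop := ∃ K, ∀ S, s.cost S ≤ K * (S + 1) ^ k

/-- With the positive base `S + 1`, straight-line code fits under every exponent and can be combined
with any loop. -/
theorem CostBound.of_const {s : Stmt} {K : ℕ} (h : ∀ S, s.cost S = K) (k : ℕ) : CostBound s k :=
  ⟨K, fun S => by rw [h]; exact Nat.le_mul_of_pos_right _ (by positivity)⟩

theorem CostBound.seq {a b : Stmt} {k : ℕ} (ha : CostBound a k) (hb : CostBound b k) :
    CostBound (Stmt.seq a b) k := by
  obtain ⟨K, hK⟩ := ha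
  obtain ⟨L, hL⟩ := hb
  exact ⟨K + L, fun S => by rw [add_mul]; exact add_le_add (hK S) (hL S)⟩

theorem CostBound.cond {a : Stmt} {k : ℕ} (ha : CostBound a k) (g : Guard) :
    CostBound (Stmt.cond g a) k := by
  obtain ⟨K, hK⟩ := ha
  refine ⟨g.prepare.length + 2 + K, fun S => ?_⟩
  rw [add_mul]
  exact add_le_add (Nat.le_mul_of_pos_right _ (by positivity)) (hK S)

theorem CostBound.loop {a : Stmt} {k : ℕ} (ha : CostBound a k) (g : Guard) :
    CostBound (Stmt.loop g a) (k + 1) := by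
  obtain ⟨K, hK⟩ := ha
  refine ⟨g.prepare.length + 2 + K, fun S => ?_⟩
  have h1 : (Stmt.loop g a).cost S ≤ (S + 1) * (g.prepare.length + 2 + a.cost S) := by
    rw [cost, add_mul, one_mul]
    omega
  have h2 : g.prepare.length + 2 + a.cost S ≤ (g.prepare.length + 2 + K) * (S + 1) ^ k := by
    rw [add_mul]
    exact add_le_add (Nat.le_mul_of_pos_right _ (by positivity)) (hK S)
  calc _ ≤ _ := h1
    _ ≤ _ := Nat.mul_le_mul_left _ h2
    _ = _ := by ring

theorem CostBound.block {α : Type*} {f : α → Stmt} {k : ℕ} (h : ∀ x, CostBound (f x) k)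
    (l : List α) : CostBound (Stmt.block f l) k := by
  induction l with
  | nil => exact CostBound.of_const (fun _ => rfl) k
  | cons x l ih => exact (h x).seq ih

theorem CostBound.guarded {a : Stmt} {k : ℕ} (ha : CostBound a k) (l : List Guard) :
    CostBound (Stmt.guarded a l) k := by
  induction l with
  | nil => exact ha
  | cons g l ih => exact ih.cond g

/-- The complete program of a statement. -/
def toProgram (s : Stmt) : Program := s.compile 0 ++ [.halt]

/-- The all-zero memory of the machine represents the state with all variables and cells zero. -/
theorem haltsWith_toProgram {S : ℕ} {s : Stmt} {input : List ℤ} {output : List ℚ}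
    (h : s.wp S (fun σ => σ.output = output) ⟨fun _ => 0, fun _ => 0, input, []⟩) :
    ∃ t ≤ s.cost S, HaltsWith s.toProgram (input.map fun z : ℤ => (z : ℝ)) t
      (output.map fun q : ℚ => (q : ℝ)) := by
  have hc : CodeAt s.toProgram 0 (s.compile 0 ++ [.halt]) := ⟨[], [], by simp [toProgram], rfl⟩
  obtain ⟨t, ht, c, σ, h1, h2, h3, h4⟩ := wp_sound (P := s.toProgram) s
    (Config.init (input.map fun z : ℤ => (z : ℝ))) _ _ hc.left
    ⟨fun v => by simp [Config.init], fun v => by simp [Config.init], rfl, rfl⟩ h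
  refine ⟨t, ht, c, h1, ?_, by rw [h3.output, h4]⟩
  rw [h2]
  exact hc.right.head

end Stmt

end RealRAM

namespace CycloTomo

open RealRAM

/-! ### The grid program -/

/-- The loop variables, counters, lengths of the lists and coordinates of two points. -/
abbrev outerVar : Var := (0, 0)
abbrev innerVar : Var := (1, 0)
abbrev countVar : Var := (2, 0)
abbrev classVar : Var := (3, 0)
abbrev dummyVar : Var := (4, 0)
abbrev lengthVar (i : ℕ) : Var := (5, i)

section LinExpr

variable {d : ℕ}

/-- The coordinates of the image of a vector of expressions under a linear map. -/
def linExpr (F : (Fin d → ℤ) →ₗ[ℤ] (Fin d → ℤ)) (es : Fin d → PolyExpr) (k : Fin d) : PolyExpr :=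
  .sum ((List.finRange d).map fun j => .times (.const (F (Pi.single j 1) k)) (es j))

theorem eval_linExpr (x : Var → ℤ) (F : (Fin d → ℤ) →ₗ[ℤ] (Fin d → ℤ)) (es : Fin d → PolyExpr)
    (k : Fin d) : (linExpr F es k).eval x = F (fun j => (es j).eval x) k := by
  rw [linExpr, PolyExpr.eval_sum, List.map_map, F.pi_apply_eq_sum_univ]
  simp only [Finset.sum_apply, Pi.smul_apply, smul_eq_mul]
  rw [← List.sum_ofFn, List.ofFn_eq_map]
  congr 1
  refine List.map_congr_left fun j _ => ?_
  have : (Pi.single j 1 : Fin d → ℤ) = fun i => if j = i then 1 else 0 := by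
    ext i
    simp [Pi.single_apply, eq_comm]
  simp [PolyExpr.eval, this, mul_comm]

end LinExpr

section Vectors

variable {d S : ℕ}

/-- Reading a vector into the variables with tag `t`. -/
theorem wp_read_vector (t : ℕ) (e : Fin d → ℤ) (rest : List ℤ) {σ : State}
    (hσ : σ.input = List.ofFn e ++ rest) :
    (Stmt.block (fun k : Fin d => .read (t, k)) (List.finRange d)).wp S
      (fun σ' => (∀ k : Fin d, σ'.vars (t, k) = e k) ∧ (∀ v : Var, v.1 ≠ t → σ'.vars v = σ.vars v) ∧
        σ'.input = rest ∧ σ'.store = σ.store ∧ σ'.output = σ.output) σ := by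
  refine Stmt.wp_mono _ ?_ (Stmt.wp_block (List.finRange d) (fun pre suf σ' =>
    (∀ k ∈ pre, σ'.vars (t, (k : ℕ)) = e k) ∧ (∀ v : Var, v.1 ≠ t → σ'.vars v = σ.vars v) ∧
        σ'.input = suf.map e ++ rest ∧ σ'.store = σ.store ∧ σ'.output = σ.output) ?_ ?_)
  · rintro σ' ⟨h1, h2, h3, h4⟩
    exact ⟨fun k => h1 k (List.mem_finRange k), h2, by simpa using h3, h4⟩
  · simp [hσ, List.ofFn_eq_map]
  · rintro pre k suf - σ' ⟨h1, h2, h3, h4, h5⟩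
    refine ⟨e k, suf.map e ++ rest, by simpa using h3, ?_, ?_, rfl, h4, h5⟩
    · intro k' hk'
      by_cases hk : k' = k
      · subst hk; simp [State.set]
      · have : k' ∈ pre := by simpa [hk] using hk'
        simp [State.set, Fin.val_inj, hk, h1 k' this]
    · intro v hv
      rw [← h2 v hv]
      exact Function.update_of_ne (fun h => hv (by rw [h])) _ _

/-- The cell for coordinate `k` of the `j`-th entry for direction `i`. -/
def arrayCell (i : ℕ) (j : ℤ) (k : ℕ) : List ℤ := [0, i, j, k]

theorem arrayCell_inj {i i' k k' : ℕ} {j j' : ℤ} :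
    arrayCell i j k = arrayCell i' j' k' ↔ i = i' ∧ j = j' ∧ k = k' := by
  simp [arrayCell]

/-- The expressions for an array cell. -/
def arrayExpr (i : ℕ) (j : Var) (k : ℕ) : List PolyExpr :=
  [.const 0, .const i, .var j, .const k]

theorem map_eval_arrayExpr (x : Var → ℤ) (i : ℕ) (j : Var) (k : ℕ) :
    (arrayExpr i j k).map (PolyExpr.eval x) = arrayCell i (x j) k := rfl

/-- Loading a vector from the array of direction `i` into the variables with tag `t`. -/
theorem wp_load_vector (t i : ℕ) (j : Var) (hj : j.1 ≠ t) (e : Fin d → ℤ) {σ : State}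
    (hσ : ∀ k : Fin d, σ.store (arrayCell i (σ.vars j) k) = e k) :
    (Stmt.block (fun k : Fin d => .load (t, k) (arrayExpr i j k)) (List.finRange d)).wp S
      (fun σ' => (∀ k : Fin d, σ'.vars (t, k) = e k) ∧ (∀ v : Var, v.1 ≠ t → σ'.vars v = σ.vars v) ∧
        σ'.store = σ.store ∧ σ'.output = σ.output) σ := by
  refine Stmt.wp_mono _ ?_ (Stmt.wp_block (List.finRange d) (fun pre suf σ' =>
    (∀ k ∈ pre, σ'.vars (t, (k : ℕ)) = e k) ∧ (∀ v : Var, v.1 ≠ t → σ'.vars v = σ.vars v) ∧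
        σ'.store = σ.store ∧ σ'.output = σ.output) ?_ ?_)
  · rintro σ' ⟨h1, h2, h3, h4⟩
    exact ⟨fun k => h1 k (List.mem_finRange k), h2, h3, h4⟩
  · simp
  · rintro pre k suf - σ' ⟨h1, h2, h4, h5⟩
    refine ⟨?_, ?_, h4, h5⟩
    · intro k' hk'
      by_cases hk : k' = k
      · subst hk
        simp [State.set, map_eval_arrayExpr, h2 j hj, h4, hσ]
      · have : k' ∈ pre := by simpa [hk] using hk'
        simp [State.set, Fin.val_inj, hk, h1 k' this]
    · intro v hv
      rw [← h2 v hv]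
      exact Function.update_of_ne (fun h => hv (by rw [h])) _ _

/-- Storing a vector into the array of direction `i`. -/
theorem wp_store_vector (t i : ℕ) (j : Var) (σ : State) :
    (Stmt.block (fun k : Fin d => .store (arrayExpr i j k) (.var (t, k))) (List.finRange d)).wp S
      (fun σ' => (∀ k : Fin d, σ'.store (arrayCell i (σ.vars j) k) = σ.vars (t, k)) ∧
        (∀ a, (∀ k : Fin d, a ≠ arrayCell i (σ.vars j) k) → σ'.store a = σ.store a) ∧
        σ'.vars = σ.vars ∧ σ'.input = σ.input ∧ σ'.output = σ.output) σ := by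
  refine Stmt.wp_mono _ ?_ (Stmt.wp_block (List.finRange d) (fun pre suf σ' =>
    (∀ k ∈ pre, σ'.store (arrayCell i (σ.vars j) (k : ℕ)) = σ.vars (t, (k : ℕ))) ∧
        (∀ a, (∀ k : Fin d, a ≠ arrayCell i (σ.vars j) k) → σ'.store a = σ.store a) ∧
        σ'.vars = σ.vars ∧ σ'.input = σ.input ∧ σ'.output = σ.output) ?_ ?_)
  · rintro σ' ⟨h1, h2⟩
    exact ⟨fun k => h1 k (List.mem_finRange k), h2⟩
  · simp
  · rintro pre k suf - σ' ⟨h1, h2, h3, h4⟩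
    refine ⟨?_, ?_, h3, h4⟩
    · intro k' hk'
      by_cases hk : k' = k
      · subst hk
        simp [map_eval_arrayExpr, h3, PolyExpr.eval]
      · have : k' ∈ pre := by simpa [hk] using hk'
        simp [map_eval_arrayExpr, h3, arrayCell_inj, Fin.val_inj, hk, h1 k' this]
    · intro a ha
      rw [← h2 a ha]
      simp only [map_eval_arrayExpr, h3]
      exact Function.update_of_ne (ha k) _ _

end Vectors

/-- The data of a grid computation with integer vectors: the lines through `t` in direction `i` are
distinguished by `key i t`, the lines through `a` in direction `i₀` and through `b` in direction
`i₁` meet in the point with coordinates `(A a + B b) / N`. -/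
structure GridData (d m : ℕ) where
  N : ℕ
  key : Fin m → (Fin d → ℤ) →ₗ[ℤ] (Fin d → ℤ)
  A : (Fin d → ℤ) →ₗ[ℤ] (Fin d → ℤ)
  B : (Fin d → ℤ) →ₗ[ℤ] (Fin d → ℤ)
  i₀ : Fin m
  i₁ : Fin m

namespace GridData

variable {d m S : ℕ} (𝒟 : GridData d m)

/-- The cell which is positive if the line with a given key is in the list. -/
def hashCell (i : Fin m) (v : Fin d → ℤ) : List ℤ := 1 :: (i : ℕ) :: List.ofFn v

theorem hashCell_inj {i i' : Fin m} {v v' : Fin d → ℤ} :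
    hashCell i v = hashCell i' v' ↔ i = i' ∧ v = v' := by
  simp [hashCell, Fin.val_inj]

/-- The leading tags 1 and 0 differ. Length alone would not separate the two kinds of cells, since
both have length 4 when d = 2. -/
theorem hashCell_ne_arrayCell (i : Fin m) (v : Fin d → ℤ) (i' k : ℕ) (j : ℤ) :
    hashCell i v ≠ arrayCell i' j k := by
  simp [hashCell, arrayCell]

/-- The expressions for a hash cell. -/
def hashExpr (i : Fin m) (es : Fin d → PolyExpr) : List PolyExpr :=
  .const 1 :: .const (i : ℕ) :: List.ofFn es

theorem map_eval_hashExpr (x : Var → ℤ) (i : Fin m) (es : Fin d → PolyExpr) :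
    (hashExpr i es).map (PolyExpr.eval x) = hashCell i fun k => (es k).eval x := by
  simp [hashExpr, hashCell, PolyExpr.eval, List.map_ofFn, Function.comp_def]

/-- The store holds the lists `D`. -/
structure Loaded (D : Fin m → List ((Fin d → ℤ) × ℕ)) (st : List ℤ → ℤ) : Prop where
  array : ∀ (i : Fin m) (j : ℕ) (h : j < (D i).length) (k : Fin d),
    st (arrayCell i j k) = (D i)[j].1 k
  hash : ∀ (i : Fin m) (v : Fin d → ℤ),
    0 < st (hashCell i v) ↔ ∃ e ∈ D i, (𝒟.N : ℤ) • 𝒟.key i e.1 = v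

/-- Reading one entry for direction `i`. -/
def readEntry (i : Fin m) : Stmt :=
  .seq (.block (fun k : Fin d => .read (6, k)) (List.finRange d)) <|
  .seq (.read dummyVar) <|
  .seq (.block (fun k : Fin d => .store (arrayExpr i outerVar k) (.var (6, k)))
    (List.finRange d)) <|
  .seq (.store (hashExpr i (linExpr ((𝒟.N : ℤ) • 𝒟.key i) fun k => .var (6, k))) (.const 1)) <|
  .set outerVar (.plus (.var outerVar) (.const 1))

/-- The part of the input tape for one entry. -/
def entryInput (e : (Fin d → ℤ) × ℕ) : List ℤ := List.ofFn e.1 ++ [(e.2 : ℤ)]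

/-- The value of an entry is consumed and dropped, because the grid depends on the supports only.
The key is stored multiplied by `N`, so that it can be compared with the key of `N` times a
candidate point without leaving the integers. -/
theorem wp_readEntry (i : Fin m) (e : (Fin d → ℤ) × ℕ) (rest : List ℤ)
    (D : Fin m → List ((Fin d → ℤ) × ℕ)) {σ : State} (h1 : σ.input = entryInput e ++ rest)
    (h2 : 𝒟.Loaded D σ.store) (h3 : σ.vars outerVar = (D i).length) :
    (𝒟.readEntry i).wp S (fun σ' => 𝒟.Loaded (Function.update D i (D i ++ [e])) σ'.store ∧
      σ'.vars outerVar = (D i).length + 1 ∧ (∀ j, σ'.vars (lengthVar j) = σ.vars (lengthVar j)) ∧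
      σ'.input = rest ∧ σ'.output = σ.output) σ := by
  refine Stmt.wp_seq
    (wp_read_vector 6 e.1 ((e.2 : ℤ) :: rest) (by rw [h1, entryInput, List.append_assoc]; rfl)) ?_
  rintro σ₁ ⟨a1, a2, a3, a4, a5⟩
  refine ⟨e.2, rest, a3, Stmt.wp_seq (wp_store_vector 6 i outerVar _) ?_⟩
  rintro σ₂ ⟨b1, b2, b3, b4, b5⟩
  have hj : σ₁.vars outerVar = (D i).length := by rw [a2 _ (by decide), h3]
  have hv : ∀ v : Var, v.1 ≠ 4 → Function.update σ₁.vars dummyVar (e.2 : ℤ) v = σ₁.vars v :=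
    fun v hv => Function.update_of_ne (fun h => hv (by rw [h])) _ _
  simp only [State.set, hv _ (show outerVar.1 ≠ 4 by simp),
    hv (6, _) (show 6 ≠ 4 by simp), hj, a1, a4] at b1 b2
  have hk : (fun k => (linExpr ((𝒟.N : ℤ) • 𝒟.key i) (fun k => .var (6, (k : ℕ))) k).eval σ₂.vars)
      = (𝒟.N : ℤ) • 𝒟.key i e.1 := by
    funext k
    rw [eval_linExpr]
    have : (fun j : Fin d => (PolyExpr.var (6, (j : ℕ))).eval σ₂.vars) = e.1 := by
      funext j
      simp [PolyExpr.eval, b3, State.set, a1]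
    rw [this]
    rfl
  refine ⟨⟨?_, ?_⟩, ?_, ?_, b4, ?_⟩
  · intro i' j h k
    simp only [State.set, map_eval_hashExpr]
    rw [Function.update_of_ne (hashCell_ne_arrayCell _ _ _ _ _).symm]
    by_cases hi : i' = i
    · subst hi
      simp only [Function.update_self] at h ⊢
      by_cases hj' : j = (D i').length
      · subst hj'
        simp [b1]
      · have hlt : j < (D i').length := by simp at h; omega
        rw [b2 _ fun k' => by simp [arrayCell_inj]; omega, h2.array i' j hlt k,
          List.getElem_append_left hlt]
    · rw [b2 _ fun k' => by simp [arrayCell_inj, Fin.val_inj, hi]]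
      simp only [Function.update_of_ne hi] at h ⊢
      exact h2.array i' j h k
  · intro i' v
    simp only [State.set, map_eval_hashExpr, hk]
    by_cases hi : hashCell i' v = hashCell i ((𝒟.N : ℤ) • 𝒟.key i e.1)
    · rw [hi, Function.update_self]
      obtain ⟨rfl, rfl⟩ := hashCell_inj.1 hi
      simp [PolyExpr.eval]
    · rw [Function.update_of_ne hi, b2 _ fun k' => hashCell_ne_arrayCell _ _ _ _ _, h2.hash]
      by_cases hi' : i' = i
      · subst hi'
        have hv : (𝒟.N : ℤ) • 𝒟.key i' e.1 ≠ v := fun h => hi (by rw [h])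
        simp only [Function.update_self, List.mem_append, List.mem_singleton, or_and_right,
          exists_or, exists_eq_left, hv, or_false]
      · rw [Function.update_of_ne hi']
  · simp [State.set, PolyExpr.eval, b3, hj]
  · intro j
    simp [State.set, b3, a2]
  · simp [State.set, b5, a5]

/-- Reading the list for direction `i`. -/
def readList (i : Fin m) : Stmt :=
  .seq (.read (lengthVar i)) <| .seq (.set outerVar (.const 0)) <|
  .loop (.lt (.var outerVar) (.var (lengthVar i))) (𝒟.readEntry i)

/-- The part of the input tape for one direction. -/
def listInput (l : List ((Fin d → ℤ) × ℕ)) : List ℤ := (l.length : ℤ) :: l.flatMap entryInput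

theorem wp_readList (i : Fin m) (l : List ((Fin d → ℤ) × ℕ)) (rest : List ℤ)
    (hS : l.length ≤ S) (D : Fin m → List ((Fin d → ℤ) × ℕ)) (hD : D i = []) {σ : State}
    (h1 : σ.input = listInput l ++ rest) (h2 : 𝒟.Loaded D σ.store) :
    (𝒟.readList i).wp S (fun σ' => 𝒟.Loaded (Function.update D i l) σ'.store ∧
      σ'.vars (lengthVar i) = l.length ∧
      (∀ j : Fin m, j ≠ i → σ'.vars (lengthVar j) = σ.vars (lengthVar j)) ∧
      σ'.input = rest ∧ σ'.output = σ.output) σ := by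
  refine ⟨l.length, l.flatMap entryInput ++ rest, h1, ?_⟩
  refine Stmt.wp_loop l hS (fun pre suf σ' => 𝒟.Loaded (Function.update D i pre) σ'.store ∧
    σ'.vars outerVar = pre.length ∧ σ'.vars (lengthVar i) = l.length ∧
    (∀ j : Fin m, j ≠ i → σ'.vars (lengthVar j) = σ.vars (lengthVar j)) ∧
    σ'.input = suf.flatMap entryInput ++ rest ∧ σ'.output = σ.output) ?_ ?_ ?_
  · refine ⟨by rwa [← hD, Function.update_eq_self], by simp [State.set, PolyExpr.eval],
      by simp [State.set], fun j hj => by simp [State.set, Fin.val_inj, hj], rfl, rfl⟩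
  · rintro pre e suf hl σ' ⟨a1, a2, a3, a4, a5, a6⟩
    refine ⟨by simp [Guard.Holds, PolyExpr.eval, a2, a3, hl], ?_⟩
    refine Stmt.wp_mono _ ?_ (𝒟.wp_readEntry i e (suf.flatMap entryInput ++ rest) _
      (by simpa using a5) a1 (by simpa using a2))
    rintro σ'' ⟨b1, b2, b3, b4, b5⟩
    refine ⟨by simpa using b1, by simpa using b2, by rw [b3, a3], fun j hj => by rw [b3, a4 j hj],
      b4, by rw [b5, a6]⟩
  · rintro σ' ⟨a1, a2, a3, a4, a5, a6⟩
    exact ⟨by simp [Guard.Holds, PolyExpr.eval, a2, a3], a1, a3, a4, by simpa using a5, a6⟩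

/-- The lists `L` have been read. -/
def Ready (L : Fin m → List ((Fin d → ℤ) × ℕ)) (σ : State) : Prop :=
  𝒟.Loaded L σ.store ∧ ∀ i : Fin m, σ.vars (lengthVar i) = (L i).length

theorem wp_readAll (L : Fin m → List ((Fin d → ℤ) × ℕ)) (hS : ∀ i, (L i).length ≤ S) :
    (Stmt.block 𝒟.readList (List.finRange m)).wp S (fun σ => 𝒟.Ready L σ ∧ σ.output = [])
      ⟨fun _ => 0, fun _ => 0, (List.finRange m).flatMap fun i => listInput (L i), []⟩ := by
  refine Stmt.wp_mono _ ?_ (Stmt.wp_block (List.finRange m) (fun pre suf σ =>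
    𝒟.Loaded (fun i => if i ∈ pre then L i else []) σ.store ∧
    (∀ i ∈ pre, σ.vars (lengthVar (i : ℕ)) = (L i).length) ∧
    σ.input = suf.flatMap (fun i => listInput (L i)) ∧ σ.output = []) ?_ ?_)
  · rintro σ ⟨h1, h2, -, h3⟩
    exact ⟨⟨by simpa using h1, fun i => h2 i (List.mem_finRange i)⟩, h3⟩
  -- The table needs no initialisation: a zero store already represents empty lists.
  · exact ⟨⟨by simp, by simp⟩, by simp, rfl, rfl⟩
  · rintro pre i suf hl σ ⟨h1, h2, h3, h4⟩
    -- Each direction is read only once, so its list is still empty at this moment.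
    have hi : i ∉ pre := by
      have := List.nodup_finRange m
      rw [hl, List.nodup_append] at this
      exact fun h => this.2.2 i h i (by simp) rfl
    refine Stmt.wp_mono _ ?_ (𝒟.wp_readList i (L i) _ (hS i) _ (by simp [hi])
      (by rw [h3]; rfl) h1)
    rintro σ' ⟨b1, b2, b3, b4, b5⟩
    refine ⟨?_, ?_, b4, by rw [b5, h4]⟩
    · convert b1 using 1
      funext j
      by_cases hj : j = i
      · subst hj; simp
      · simp [hj]
    · intro j hj
      by_cases hji : j = i
      · subst hji; exact b2
      · rw [b3 j hji, h2 j (by simpa [hji] using hj)]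

/-! ### The double loop over pairs of lines -/

/-- Run through all pairs of lines for the directions `i₀` and `i₁`. -/
def scan (a : Stmt) : Stmt :=
  .seq (.set outerVar (.const 0)) <|
  .loop (.lt (.var outerVar) (.var (lengthVar 𝒟.i₀))) <|
  .seq (.block (fun k : Fin d => .load (6, k) (arrayExpr 𝒟.i₀ outerVar k)) (List.finRange d)) <|
  .seq (.set innerVar (.const 0)) <|
  .seq (.loop (.lt (.var innerVar) (.var (lengthVar 𝒟.i₁))) <|
    .seq (.block (fun k : Fin d => .load (7, k) (arrayExpr 𝒟.i₁ innerVar k)) (List.finRange d)) <|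
    .seq a (.set innerVar (.plus (.var innerVar) (.const 1)))) <|
  .set outerVar (.plus (.var outerVar) (.const 1))

/-- The lists `L` have been read, and the counters and the output are as given. -/
structure At (L : Fin m → List ((Fin d → ℤ) × ℕ)) (c t : ℤ) (out : List ℚ) (σ : State) :
    Prop where
  ready : 𝒟.Ready L σ
  count : σ.vars countVar = c
  classes : σ.vars classVar = t
  output : σ.output = out

variable {𝒟}

/-- Tags 2 to 5 hold the counters and the list lengths; the scan itself writes only to the loop
variables, tags 0 and 1, and to the two vectors, tags 6 and 7. -/
theorem At.congr {L : Fin m → List ((Fin d → ℤ) × ℕ)} {c t : ℤ} {out : List ℚ} {σ σ' : State}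
    (h : 𝒟.At L c t out σ) (h1 : σ'.store = σ.store) (h2 : σ'.output = σ.output)
    (h3 : ∀ v : Var, 2 ≤ v.1 → v.1 ≤ 5 → σ'.vars v = σ.vars v) : 𝒟.At L c t out σ' where
  ready := ⟨h1 ▸ h.ready.1, fun i => by rw [h3 _ (by simp) (by simp)]; exact h.ready.2 i⟩
  count := by rw [h3 _ (by simp) (by simp)]; exact h.count
  classes := by rw [h3 _ (by simp) (by simp)]; exact h.classes
  output := by rw [h2]; exact h.output

theorem At.set {L : Fin m → List ((Fin d → ℤ) × ℕ)} {c t : ℤ} {out : List ℚ} {σ : State}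
    (h : 𝒟.At L c t out σ) {v : Var} (hv : v.1 < 2) (z : ℤ) : 𝒟.At L c t out (σ.set v z) :=
  h.congr rfl rfl fun w hw _ => Function.update_of_ne (fun hwv => by subst hwv; omega) _ _

/-- The state after increasing the counter by `c` and writing `out`. -/
def advance (σ : State) (c : ℤ) (out : List ℚ) : State :=
  { σ with vars := Function.update σ.vars countVar (σ.vars countVar + c), output := σ.output ++ out }

theorem At.advance {L : Fin m → List ((Fin d → ℤ) × ℕ)} {c t : ℤ} {out : List ℚ} {σ : State}
    (h : 𝒟.At L c t out σ) (c' : ℤ) (out' : List ℚ) :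
    𝒟.At L (c + c') t (out ++ out') (GridData.advance σ c' out') where
  ready := ⟨h.ready.1, fun i => by simpa [GridData.advance] using h.ready.2 i⟩
  count := by simp [GridData.advance, h.count]
  classes := by simp [GridData.advance, h.classes]
  output := by simp [GridData.advance, h.output]

/-- The contract on the body, namely that it only adds to the counter and appends to the output by
amounts depending on the current pair, covers both counting and writing. -/
theorem wp_scan {L : Fin m → List ((Fin d → ℤ) × ℕ)} (hS : ∀ i, (L i).length ≤ S) {a : Stmt}
    {c : (Fin d → ℤ) → (Fin d → ℤ) → ℤ} {o : (Fin d → ℤ) → (Fin d → ℤ) → List ℚ}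
    (ha : ∀ (x y : Fin d → ℤ) σ, 𝒟.Ready L σ → (∀ k : Fin d, σ.vars (6, k) = x k) →
      (∀ k : Fin d, σ.vars (7, k) = y k) → a.wp S (fun σ' => σ' = advance σ (c x y) (o x y)) σ)
    {c₀ t : ℤ} {out : List ℚ} {σ : State} (hσ : 𝒟.At L c₀ t out σ) :
    (𝒟.scan a).wp S (𝒟.At L
      (c₀ + ((L 𝒟.i₀).map fun x => ((L 𝒟.i₁).map fun y => c x.1 y.1).sum).sum) t
      (out ++ (L 𝒟.i₀).flatMap fun x => (L 𝒟.i₁).flatMap fun y => o x.1 y.1)) σ := by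
  refine Stmt.wp_loop (L 𝒟.i₀) (hS _) (fun pre suf σ' => σ'.vars outerVar = pre.length ∧
    𝒟.At L (c₀ + (pre.map fun x => ((L 𝒟.i₁).map fun y => c x.1 y.1).sum).sum) t
      (out ++ pre.flatMap fun x => (L 𝒟.i₁).flatMap fun y => o x.1 y.1) σ') ?_ ?_ ?_
  · refine ⟨by simp [State.set, PolyExpr.eval], ?_⟩
    simpa using hσ.set (v := outerVar) (by simp) _
  · rintro pre x suf hl σ₁ ⟨h1, h2⟩
    have hlen : (L 𝒟.i₀).length = pre.length + (suf.length + 1) := by simp [hl]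
    refine ⟨by simp [Guard.Holds, PolyExpr.eval, h1, h2.ready.2, hlen], ?_⟩
    refine Stmt.wp_seq (wp_load_vector 6 𝒟.i₀ outerVar (by simp) x.1 fun k => by
      rw [h1, h2.ready.1.array 𝒟.i₀ pre.length (by omega)]
      simp [hl]) ?_
    rintro σ₂ ⟨a1, a2, a3, a4⟩
    have h2' := h2.congr a3 a4 fun v _ hv => a2 v (by omega)
    have h1' : σ₂.vars outerVar = pre.length := by rw [a2 _ (by simp), h1]
    refine Stmt.wp_loop (L 𝒟.i₁) (hS _) (fun pre' suf' σ' => σ'.vars outerVar = pre.length ∧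
      σ'.vars innerVar = pre'.length ∧ (∀ k : Fin d, σ'.vars (6, k) = x.1 k) ∧
      𝒟.At L (c₀ + (pre.map fun x => ((L 𝒟.i₁).map fun y => c x.1 y.1).sum).sum
          + (pre'.map fun y => c x.1 y.1).sum) t
        ((out ++ pre.flatMap fun x => (L 𝒟.i₁).flatMap fun y => o x.1 y.1)
          ++ pre'.flatMap fun y => o x.1 y.1) σ') ?_ ?_ ?_
    · refine ⟨by simpa [State.set] using h1', by simp [State.set, PolyExpr.eval],
        by simpa [State.set] using a1, ?_⟩
      simpa using h2'.set (v := innerVar) (by simp) _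
    · rintro pre' y suf' hl' σ₃ ⟨b1, b2, b3, b4⟩
      have hlen' : (L 𝒟.i₁).length = pre'.length + (suf'.length + 1) := by simp [hl']
      refine ⟨by simp [Guard.Holds, PolyExpr.eval, b2, b4.ready.2, hlen'], ?_⟩
      refine Stmt.wp_seq (wp_load_vector 7 𝒟.i₁ innerVar (by simp) y.1 fun k => by
        rw [b2, b4.ready.1.array 𝒟.i₁ pre'.length (by omega)]
        simp [hl']) ?_
      rintro σ₄ ⟨e1, e2, e3, e4⟩
      have b4' := b4.congr e3 e4 fun v _ hv => e2 v (by omega)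
      refine Stmt.wp_seq (ha x.1 y.1 σ₄ b4'.ready
        (fun k => by rw [e2 _ (by simp), b3]) e1) ?_
      rintro σ₅ rfl
      refine ⟨?_, ?_, ?_, ?_⟩
      · simp [State.set, GridData.advance, e2, b1]
      · simp [State.set, GridData.advance, e2, b2, PolyExpr.eval]
      · simp [State.set, GridData.advance, e2, b3]
      · have := (b4'.advance (c x.1 y.1) (o x.1 y.1)).set (v := innerVar) (by simp)
          ((PolyExpr.plus (.var innerVar) (.const 1)).eval
            (advance σ₄ (c x.1 y.1) (o x.1 y.1)).vars)
        simpa [add_assoc] using this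
    · rintro σ₃ ⟨b1, b2, b3, b4⟩
      refine ⟨by simp [Guard.Holds, PolyExpr.eval, b2, b4.ready.2],
        by simp [State.set, PolyExpr.eval, b1], ?_⟩
      have := b4.set (v := outerVar) (by simp)
        ((PolyExpr.plus (.var outerVar) (.const 1)).eval σ₃.vars)
      simpa [add_assoc] using this
  · rintro σ' ⟨h1, h2⟩
    exact ⟨by simp [Guard.Holds, PolyExpr.eval, h1, h2.ready.2], h2⟩

variable (𝒟)

/-- The expressions for `N` times the intersection point of the current lines. -/
def pointExpr (k : Fin d) : PolyExpr :=
  .plus (linExpr 𝒟.A (fun k => .var (6, k)) k) (linExpr 𝒟.B (fun k => .var (7, k)) k)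

/-- The guards for the grid points in the class of `v / N`. -/
def guards (v : Fin d → ℤ) : List Guard :=
  ((List.finRange m).map fun i => .pos (hashExpr i (linExpr (𝒟.key i) 𝒟.pointExpr))) ++
  (List.finRange d).map fun k => .int (.plus (𝒟.pointExpr k) (.const (-v k))) (1 / 𝒟.N)

/-- The vector `w / N` is in the class of `v / N` and on a line from every list. -/
def Accepts (L : Fin m → List ((Fin d → ℤ) × ℕ)) (v w : Fin d → ℤ) : Prop :=
  (∀ i, ∃ e ∈ L i, (𝒟.N : ℤ) • 𝒟.key i e.1 = 𝒟.key i w) ∧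
    ∀ k, ∃ z : ℤ, ((w k - v k : ℤ) : ℚ) * (1 / 𝒟.N) = z

/-- For w = `A x + B y`, the lookups compare the key of w with the stored multiples of the keys, and
integrality of (w − v)/N selects the class. The directions `i₀` and `i₁` are tested along with the
others for uniformity. -/
theorem guards_hold_iff {L : Fin m → List ((Fin d → ℤ) × ℕ)} (v x y : Fin d → ℤ) {σ : State}
    (h : 𝒟.Ready L σ) (hx : ∀ k : Fin d, σ.vars (6, k) = x k)
    (hy : ∀ k : Fin d, σ.vars (7, k) = y k) :
    (∀ k, (𝒟.pointExpr k).eval σ.vars = (𝒟.A x + 𝒟.B y) k) ∧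
    ((∀ g ∈ 𝒟.guards v, g.Holds σ) ↔ 𝒟.Accepts L v (𝒟.A x + 𝒟.B y)) := by
  have hp : ∀ k, (𝒟.pointExpr k).eval σ.vars = (𝒟.A x + 𝒟.B y) k := by
    intro k
    simp [pointExpr, PolyExpr.eval, eval_linExpr, hx, hy]
  refine ⟨hp, ?_⟩
  simp only [guards, List.mem_append, or_imp, forall_and, List.forall_mem_map, List.mem_finRange,
    forall_const, Guard.Holds, map_eval_hashExpr, h.1.hash, Accepts, PolyExpr.eval, hp,
    eval_linExpr, sub_eq_add_neg]

open Classical in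
/-- The grid points in the class of `v / N`. -/
noncomputable def points (L : Fin m → List ((Fin d → ℤ) × ℕ)) (v : Fin d → ℤ) :
    List (Fin d → ℚ) :=
  (L 𝒟.i₀).flatMap fun x => (L 𝒟.i₁).flatMap fun y =>
    if 𝒟.Accepts L v (𝒟.A x.1 + 𝒟.B y.1) then
      [fun k => ((𝒟.A x.1 + 𝒟.B y.1) k : ℚ) * (1 / 𝒟.N)] else []

/-- Count the points of a class. -/
def countPoints (v : Fin d → ℤ) : Stmt :=
  .seq (.set countVar (.const 0)) <|
  𝒟.scan (.guarded (.set countVar (.plus (.var countVar) (.const 1))) (𝒟.guards v))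

/-- Write the points of a class. -/
def writePoints (v : Fin d → ℤ) : Stmt :=
  𝒟.scan (.guarded
    (.block (fun k => .write (𝒟.pointExpr k) (1 / 𝒟.N)) (List.finRange d)) (𝒟.guards v))

open Classical in
theorem wp_countPoints {L : Fin m → List ((Fin d → ℤ) × ℕ)} (hS : ∀ i, (L i).length ≤ S)
    (v : Fin d → ℤ) {c t : ℤ} {out : List ℚ} {σ : State} (hσ : 𝒟.At L c t out σ) :
    (𝒟.countPoints v).wp S (𝒟.At L (𝒟.points L v).length t out) σ := by
  have h0 : 𝒟.At L 0 t out (σ.set countVar 0) :=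
    ⟨⟨hσ.ready.1, fun i => by simpa [State.set] using hσ.ready.2 i⟩, by simp [State.set],
      by simpa [State.set] using hσ.classes, hσ.output⟩
  have := wp_scan (S := S) hS
    (a := .guarded (.set countVar (.plus (.var countVar) (.const 1))) (𝒟.guards v))
    (c := fun x y => if 𝒟.Accepts L v (𝒟.A x + 𝒟.B y) then 1 else 0) (o := fun _ _ => [])
    (fun x y σ hr hx hy => by
      refine Stmt.wp_guarded _ ?_ ?_ <;> rw [(𝒟.guards_hold_iff v x y hr hx hy).2] <;> intro h
      · simp [h, Stmt.wp, advance, State.set, PolyExpr.eval]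
      · simp [h, advance]) h0
  refine Stmt.wp_mono _ (fun σ' h' => ?_) this
  convert h' using 1
  · rw [zero_add, points, List.length_flatMap]
    push_cast
    simp only [List.length_flatMap, List.map_map, Function.comp_def, Nat.cast_list_sum]
    congr! 6
    split_ifs <;> rfl
  · simp

open Classical in
theorem wp_writePoints {L : Fin m → List ((Fin d → ℤ) × ℕ)} (hS : ∀ i, (L i).length ≤ S)
    (v : Fin d → ℤ) {c t : ℤ} {out : List ℚ} {σ : State} (hσ : 𝒟.At L c t out σ) :
    (𝒟.writePoints v).wp S (𝒟.At L c t (out ++ (𝒟.points L v).flatMap List.ofFn)) σ := by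
  have := wp_scan (S := S) hS
    (a := .guarded
      (.block (fun k => .write (𝒟.pointExpr k) (1 / 𝒟.N)) (List.finRange d)) (𝒟.guards v))
    (c := fun _ _ => 0) (o := fun x y => if 𝒟.Accepts L v (𝒟.A x + 𝒟.B y) then
      List.ofFn fun k => ((𝒟.A x + 𝒟.B y) k : ℚ) * (1 / 𝒟.N) else [])
    (fun x y σ hr hx hy => by
      obtain ⟨h1, h2⟩ := 𝒟.guards_hold_iff v x y hr hx hy
      refine Stmt.wp_guarded _ ?_ ?_ <;> rw [h2] <;> intro h
      · rw [if_pos h]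
        refine Stmt.wp_mono _ ?_ (Stmt.wp_block (List.finRange d) (fun pre suf σ' =>
          σ' = { σ with
            output := σ.output ++ pre.map fun k => ((𝒟.A x + 𝒟.B y) k : ℚ) * (1 / 𝒟.N) })
          (by simp) ?_)
        · rintro _ rfl
          simp [advance, List.ofFn_eq_map]
        · rintro pre k suf - _ rfl
          simp [Stmt.wp, h1]
      · simp [h, advance]) hσ
  refine Stmt.wp_mono _ (fun σ' h' => ?_) this
  convert h' using 1
  · simp
  · rw [points]
    simp only [List.flatMap_assoc]
    congr! 6
    split_ifs <;> simp

/-- The grid program; `R` lists representatives `v` of the residue classes modulo `N`. -/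
def program (R : List (Fin d → ℤ)) : Stmt :=
  .seq (.block 𝒟.readList (List.finRange m)) <|
  .seq (.set classVar (.const 0)) <|
  .seq (.block (fun v => .seq (𝒟.countPoints v) (.cond (.lt (.const 0) (.var countVar))
    (.set classVar (.plus (.var classVar) (.const 1))))) R) <|
  .seq (.write (.var classVar) 1) <|
  .block (fun v => .seq (𝒟.countPoints v) (.cond (.lt (.const 0) (.var countVar))
    (.seq (.write (.var countVar) 1) (𝒟.writePoints v)))) R

open Classical in
/-- The nonempty classes of grid points. -/
noncomputable def classes (L : Fin m → List ((Fin d → ℤ) × ℕ)) (R : List (Fin d → ℤ)) :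
    List (List (Fin d → ℚ)) :=
  (R.map (𝒟.points L)).filter (· ≠ [])

/-- The output tape for a list of classes. -/
def tape (Q : List (List (Fin d → ℚ))) : List ℚ :=
  (Q.length : ℚ) :: Q.flatMap fun l => (l.length : ℚ) :: l.flatMap List.ofFn

/-- The output can only be appended to, while the number of classes and the length of each class
precede their contents. Hence the classes are counted in a first pass, and in the second each is
counted again before it is written. -/
theorem wp_program {L : Fin m → List ((Fin d → ℤ) × ℕ)} (hS : ∀ i, (L i).length ≤ S)
    (R : List (Fin d → ℤ)) :
    (𝒟.program R).wp S (fun σ => σ.output = tape (𝒟.classes L R))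
      ⟨fun _ => 0, fun _ => 0, (List.finRange m).flatMap fun i => listInput (L i), []⟩ := by
  classical
  have hpos : ∀ v {t : ℤ} {out : List ℚ} {σ : State}, 𝒟.At L (𝒟.points L v).length t out σ →
      ((Guard.lt (.const 0) (.var countVar)).Holds σ ↔ 𝒟.points L v ≠ []) := by
    intro v t out σ h
    simp [Guard.Holds, PolyExpr.eval, h.count, List.length_pos_iff]
  refine Stmt.wp_seq (𝒟.wp_readAll L hS) ?_
  rintro σ ⟨h1, h2⟩
  refine Stmt.wp_seq (R := fun σ' => 𝒟.At L (σ'.vars countVar) 0 [] σ')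
    ⟨⟨h1.1, fun i => by simpa [State.set] using h1.2 i⟩, rfl,
      by simp [State.set, PolyExpr.eval], h2⟩ fun σ' hσ' => ?_
  refine Stmt.wp_seq (Stmt.wp_block R (fun pre _ σ =>
    ∃ c, 𝒟.At L c (𝒟.classes L pre).length [] σ) ?_ ?_) ?_
  · exact ⟨σ'.vars countVar, hσ'⟩
  · rintro pre v suf - σ ⟨c, h⟩
    refine Stmt.wp_seq (𝒟.wp_countPoints hS v h) fun σ' h' => ?_
    rw [Stmt.wp, hpos v h']
    by_cases hv : 𝒟.points L v = []
    · rw [if_neg (by simpa using hv)]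
      exact ⟨_, by simpa [classes, hv] using h'⟩
    · rw [if_pos hv]
      refine ⟨_, ⟨h'.ready.1, fun i => by simpa [State.set] using h'.ready.2 i⟩, rfl, ?_,
        h'.output⟩
      simp [State.set, PolyExpr.eval, h'.classes, classes, hv]
  rintro σ ⟨c, h⟩
  refine Stmt.wp_mono _ ?_ (Stmt.wp_block R (fun pre _ σ =>
    ∃ c t, 𝒟.At L c t (((𝒟.classes L R).length : ℚ) :: (𝒟.classes L pre).flatMap fun l =>
      (l.length : ℚ) :: l.flatMap List.ofFn) σ) ?_ ?_)
  · rintro σ ⟨c, t, h⟩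
    exact h.output
  · exact ⟨c, _, h.ready, h.count, h.classes, by
      simp [h.output, PolyExpr.eval, h.classes, classes]⟩
  · rintro pre v suf - σ ⟨c, t, h⟩
    refine Stmt.wp_seq (𝒟.wp_countPoints hS v h) fun σ' h' => ?_
    rw [Stmt.wp, hpos v h']
    by_cases hv : 𝒟.points L v = []
    · rw [if_neg (by simpa using hv)]
      exact ⟨_, _, by simpa [classes, hv] using h'⟩
    · rw [if_pos hv]
      refine Stmt.wp_mono _ ?_ (𝒟.wp_writePoints hS v (σ :=
        { σ' with output := σ'.output ++ [(σ'.vars countVar : ℚ) * 1] })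
        ⟨h'.ready, rfl, rfl, rfl⟩)
      intro σ'' h''
      refine ⟨_, _, h''.ready, rfl, rfl, ?_⟩
      rw [h''.output]
      simp [classes, hv, h'.output, h'.count]

/-! ### The running time of the grid program -/

/-- Only the two nested loops depend on the input; `d`, `m` and the matrices are fixed. -/
theorem costBound_scan {a : Stmt} (ha : Stmt.CostBound a 0) : Stmt.CostBound (𝒟.scan a) 2 :=
  .seq (.of_const (fun _ => rfl) _) <| .loop
    (.seq (.block (fun _ => .of_const (fun _ => rfl) _) _) <| .seq (.of_const (fun _ => rfl) _) <|
      .seq (.loop (.seq (.block (fun _ => .of_const (fun _ => rfl) _) _) <| .seq ha <|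
        .of_const (fun _ => rfl) _) _) <| .of_const (fun _ => rfl) _) _

theorem costBound_countPoints (v : Fin d → ℤ) : Stmt.CostBound (𝒟.countPoints v) 2 :=
  .seq (.of_const (fun _ => rfl) _) <| 𝒟.costBound_scan <| .guarded (.of_const (fun _ => rfl) _) _

theorem costBound_writePoints (v : Fin d → ℤ) : Stmt.CostBound (𝒟.writePoints v) 2 :=
  𝒟.costBound_scan <| .guarded (.block (fun _ => .of_const (fun _ => rfl) _) _) _

theorem costBound_readList (i : Fin m) : Stmt.CostBound (𝒟.readList i) 2 :=
  .seq (.of_const (fun _ => rfl) _) <| .seq (.of_const (fun _ => rfl) _) <| .loop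
    (.seq (.block (fun _ => .of_const (fun _ => rfl) _) _) <| .seq (.of_const (fun _ => rfl) _) <|
      .seq (.block (fun _ => .of_const (fun _ => rfl) _) _) <|
      .seq (.of_const (fun _ => rfl) _) <| .of_const (fun _ => rfl) _) _

/-- The residues `R` are unrolled in the program text, so they contribute a constant factor. -/
theorem costBound_program (R : List (Fin d → ℤ)) : Stmt.CostBound (𝒟.program R) 2 :=
  .seq (.block 𝒟.costBound_readList _) <| .seq (.of_const (fun _ => rfl) _) <|
    .seq (.block (fun v => .seq (𝒟.costBound_countPoints v) <|
      .cond (.of_const (fun _ => rfl) _) _) _) <|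
    .seq (.of_const (fun _ => rfl) _) <|
    .block (fun v => .seq (𝒟.costBound_countPoints v) <|
      .cond (.seq (.of_const (fun _ => rfl) _) (𝒟.costBound_writePoints v)) _) _

end GridData

end CycloTomo

namespace CycloTomo

open ComplexConjugate Polynomial

/-! ### Coordinates in the cyclotomic ring -/

section Coordinates

variable {n : ℕ} {ζ : ℂ}

theorem linearIndependent_zeta_pow (hn : 0 < n) (hζ : IsPrimitiveRoot ζ n) :
    LinearIndependent ℚ fun k : Fin (Nat.totient n) => ζ ^ (k : ℕ) := by
  have h : (minpoly ℚ ζ).natDegree = Nat.totient n := by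
    rw [← cyclotomic_eq_minpoly_rat hζ hn, natDegree_cyclotomic]
  have := linearIndependent_pow (K := ℚ) ζ
  rwa [h] at this

theorem ofCoords_injective (hn : 0 < n) (hζ : IsPrimitiveRoot ζ n) :
    Function.Injective (ofCoords (n := n) ζ) := by
  intro q q' h
  have := Fintype.linearIndependent_iff.1 (linearIndependent_zeta_pow hn hζ) (q - q') (by
    simp only [ofCoords] at h
    simp only [Pi.sub_apply, Algebra.smul_def, eq_ratCast, Rat.cast_sub, sub_mul,
      Finset.sum_sub_distrib, h, sub_self])
  funext k
  exact sub_eq_zero.1 (this k)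

/-- The number with given integer coordinates. -/
noncomputable def ofIntCoords (n : ℕ) (ζ : ℂ) : (Fin (Nat.totient n) → ℤ) →ₗ[ℤ] ℂ :=
  Fintype.linearCombination ℤ fun k => ζ ^ (k : ℕ)

theorem ofCoords_intCast (v : Fin (Nat.totient n) → ℤ) :
    ofCoords ζ (fun k => (v k : ℚ)) = ofIntCoords n ζ v := by
  simp [ofCoords, ofIntCoords, Fintype.linearCombination_apply]

theorem ofCoords_mul (v : Fin (Nat.totient n) → ℤ) (q : ℚ) :
    ofCoords ζ (fun k => (v k : ℚ) * q) = ofIntCoords n ζ v * q := by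
  rw [← ofCoords_intCast, ofCoords, ofCoords, Finset.sum_mul]
  refine Finset.sum_congr rfl fun k _ => ?_
  push_cast
  ring

theorem ofIntCoords_injective (hn : 0 < n) (hζ : IsPrimitiveRoot ζ n) :
    Function.Injective (ofIntCoords n ζ) := by
  intro v v' h
  rw [← ofCoords_intCast, ← ofCoords_intCast] at h
  funext k
  exact_mod_cast congrFun (ofCoords_injective hn hζ h) k

theorem zeta_mem_moduleO : ζ ∈ moduleO ζ := Algebra.self_mem_adjoin_singleton ℤ ζ

/-- An integer polynomial in ζ is replaced by its remainder modulo the cyclotomic polynomial, which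
is monic and vanishes at ζ. -/
theorem mem_moduleO_iff (hn : 0 < n) (hζ : IsPrimitiveRoot ζ n) {z : ℂ} :
    z ∈ moduleO ζ ↔ ∃ v, ofIntCoords n ζ v = z := by
  constructor
  · intro h
    rw [moduleO, Algebra.adjoin_singleton_eq_range_aeval] at h
    obtain ⟨p, rfl⟩ := h
    have hroot : aeval ζ (cyclotomic n ℤ) = 0 := by
      rw [aeval_def, eval₂_eq_eval_map, map_cyclotomic]
      exact hζ.isRoot_cyclotomic hn
    have hdeg : (p %ₘ cyclotomic n ℤ).natDegree < Nat.totient n := by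
      rw [← natDegree_cyclotomic n ℤ]
      -- The strict degree bound requires a divisor other than 1; here its degree φ(n) is positive.
      refine natDegree_modByMonic_lt _ (cyclotomic.monic n ℤ) fun h => ?_
      have := natDegree_cyclotomic n ℤ
      rw [h, natDegree_one] at this
      exact (Nat.totient_pos.2 hn).ne this
    refine ⟨fun k => (p %ₘ cyclotomic n ℤ).coeff k, ?_⟩
    have : aeval ζ (p %ₘ cyclotomic n ℤ) = aeval ζ p :=
      aeval_modByMonic_eq_self_of_root hroot
    change _ = aeval ζ p
    rw [← this, aeval_eq_sum_range' hdeg, ← Fin.sum_univ_eq_sum_range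
      (fun k => (p %ₘ cyclotomic n ℤ).coeff k • ζ ^ k)]
    simp [ofIntCoords, Fintype.linearCombination_apply]
  · rintro ⟨v, rfl⟩
    rw [ofIntCoords, Fintype.linearCombination_apply]
    exact sum_mem fun k _ => zsmul_mem (pow_mem zeta_mem_moduleO _) _

theorem ofCoords_mem_moduleO_iff (hn : 0 < n) (hζ : IsPrimitiveRoot ζ n)
    (q : Fin (Nat.totient n) → ℚ) :
    ofCoords ζ q ∈ moduleO ζ ↔ ∀ k, ∃ z : ℤ, q k = (z : ℚ) := by
  rw [mem_moduleO_iff hn hζ]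
  constructor
  · rintro ⟨v, hv⟩ k
    rw [← ofCoords_intCast] at hv
    exact ⟨v k, (congrFun (ofCoords_injective hn hζ hv) k).symm⟩
  · intro h
    choose v hv using h
    exact ⟨v, by rw [← ofCoords_intCast]; congr 1; funext k; exact (hv k).symm⟩

/-- This turns complex arithmetic into integer matrices, which can be program constants. Additivity
suffices, so conjugation is allowed. -/
theorem exists_linearMap_of_additive (hn : 0 < n) (hζ : IsPrimitiveRoot ζ n) (g : ℂ → ℂ)
    (hg : ∀ x y, g (x + y) = g x + g y) (hO : ∀ z ∈ moduleO ζ, g z ∈ moduleO ζ) :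
    ∃ F : (Fin (Nat.totient n) → ℤ) →ₗ[ℤ] (Fin (Nat.totient n) → ℤ),
      ∀ v, ofIntCoords n ζ (F v) = g (ofIntCoords n ζ v) := by
  let G : ℂ →ₗ[ℤ] ℂ := (AddMonoidHom.mk' g hg).toIntLinearMap
  let e := LinearEquiv.ofInjective (ofIntCoords n ζ) (ofIntCoords_injective hn hζ)
  have h : ∀ v, (G ∘ₗ ofIntCoords n ζ) v ∈ LinearMap.range (ofIntCoords n ζ) := fun v =>
    (mem_moduleO_iff hn hζ).1 (hO _ ((mem_moduleO_iff hn hζ).2 ⟨v, rfl⟩))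
  refine ⟨e.symm.toLinearMap ∘ₗ LinearMap.codRestrict _ _ h, fun v => ?_⟩
  have := e.apply_symm_apply (LinearMap.codRestrict _ _ h v)
  exact congrArg Subtype.val this

/-- As ζ has absolute value 1, its conjugate is its inverse, the power with exponent n − 1. -/
theorem conj_mem_moduleO (hn : 0 < n) (hζ : IsPrimitiveRoot ζ n) {z : ℂ} (hz : z ∈ moduleO ζ) :
    conj z ∈ moduleO ζ := by
  have hconj : conj ζ = ζ ^ (n - 1) := by
    have h1 : ζ ^ (n - 1) * ζ = 1 := by rw [← pow_succ, Nat.sub_add_cancel hn, hζ.pow_eq_one]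
    have h2 : conj ζ * ζ = 1 := by
      rw [mul_comm, Complex.mul_conj, Complex.normSq_eq_norm_sq, hζ.norm'_eq_one hn.ne']
      simp
    exact mul_right_cancel₀ (hζ.ne_zero hn.ne') (h2.trans h1.symm)
  obtain ⟨v, rfl⟩ := (mem_moduleO_iff hn hζ).1 hz
  rw [ofIntCoords, Fintype.linearCombination_apply, map_sum]
  refine sum_mem fun k _ => ?_
  rw [map_zsmul, map_pow, hconj]
  exact zsmul_mem (pow_mem (pow_mem zeta_mem_moduleO _) _) _

/-- A nonzero element integral over ℤ divides a nonzero integer inside the ring; a further integer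
factor makes that integer positive. -/
theorem exists_mul_eq_natCast (hn : 0 < n) (hζ : IsPrimitiveRoot ζ n) {D : ℂ}
    (hD : D ∈ moduleO ζ) (h0 : D ≠ 0) : ∃ E ∈ moduleO ζ, ∃ N : ℕ, 0 < N ∧ D * E = N := by
  have hint : IsIntegral ℤ D := adjoin_le_integralClosure (hζ.isIntegral hn) hD
  have hint' : IsIntegral ℤ (⟨D, hD⟩ : moduleO ζ) :=
    (isIntegral_algHom_iff (moduleO ζ).val Subtype.val_injective).1 hint
  obtain ⟨r, hr, E, hE⟩ := hint'.isAlgebraic.exists_nonzero_dvd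
    (mem_nonZeroDivisors_of_ne_zero fun h => h0 (congrArg Subtype.val h))
  have hE' : (r : ℂ) = D * E := by simpa using congrArg Subtype.val hE
  obtain ⟨s, hs⟩ : r ∣ (r.natAbs : ℤ) := Int.dvd_natAbs_self
  refine ⟨E * s, mul_mem E.2 (intCast_mem _ s), r.natAbs, Int.natAbs_pos.2 hr, ?_⟩
  rw [← mul_assoc, ← hE', ← Int.cast_mul, ← hs, Int.cast_natCast]

end Coordinates

/-! ### Lines and their invariants -/

/-- The lines with direction `o` are the fibres of this map. -/
noncomputable def lineInvariant (o z : ℂ) : ℂ := z * conj o - conj z * o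

theorem lineInvariant_add (o x y : ℂ) :
    lineInvariant o (x + y) = lineInvariant o x + lineInvariant o y := by
  simp only [lineInvariant, map_add]
  ring

theorem lineInvariant_mul_real (o z : ℂ) (r : ℝ) :
    lineInvariant o (z * r) = lineInvariant o z * r := by
  simp only [lineInvariant, map_mul, Complex.conj_ofReal]
  ring

/-- Equality of the invariants says that (z − t)/o equals its own conjugate, that is, is real. The
invariant is 2i times the imaginary part of z·conj(o), in a form that keeps its values in ℤ[ζ]. -/
theorem mem_lineSet_iff {o t z : ℂ} (ho : o ≠ 0) :
    z ∈ lineSet t o ↔ lineInvariant o z = lineInvariant o t := by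
  have ho' : conj o ≠ 0 := by simpa using ho
  constructor
  · rintro ⟨r, rfl⟩
    simp only [lineInvariant, map_add, map_mul, Complex.conj_ofReal]
    ring
  · intro h
    have h1 : conj ((z - t) / o) = (z - t) / o := by
      rw [map_div₀, div_eq_div_iff ho' ho, map_sub]
      simp only [lineInvariant] at h
      linear_combination -h
    obtain ⟨r, hr⟩ := Complex.conj_eq_iff_real.1 h1
    refine ⟨r, ?_⟩
    rw [← hr, div_mul_cancel₀ _ ho]
    ring

theorem lineSet_eq_iff {o t t' : ℂ} (ho : o ≠ 0) :
    lineSet t o = lineSet t' o ↔ lineInvariant o t = lineInvariant o t' := by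
  rw [← mem_lineSet_iff ho]
  constructor
  · rintro h
    rw [← h, mem_lineSet_iff ho]
  · intro h
    ext z
    rw [mem_lineSet_iff ho, mem_lineSet_iff ho, (mem_lineSet_iff ho).1 h]

theorem lineInvariant_mem {n : ℕ} {ζ : ℂ} (hn : 0 < n) (hζ : IsPrimitiveRoot ζ n) {o z : ℂ}
    (ho : o ∈ moduleO ζ) (hz : z ∈ moduleO ζ) : lineInvariant o z ∈ moduleO ζ :=
  sub_mem (mul_mem hz (conj_mem_moduleO hn hζ ho)) (mul_mem (conj_mem_moduleO hn hζ hz) ho)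

theorem lineInvariant_ne_zero {o o' : ℂ} (h : LinearIndependent ℝ ![o, o']) :
    lineInvariant o o' ≠ 0 := by
  intro h0
  have ho : o ≠ 0 := h.ne_zero 0
  obtain ⟨r, hr⟩ := (mem_lineSet_iff (t := 0) (z := o') ho).2 (by rw [h0]; simp [lineInvariant])
  have := LinearIndependent.pair_iff.1 h r (-1) (by rw [hr]; simp)
  norm_num at this

/-- Cramer's rule: z·λ_o(o') = λ_o(z)·o' − λ_{o'}(z)·o for all z. -/
theorem eq_of_lineInvariant_eq {o o' z z' : ℂ} (h : lineInvariant o o' ≠ 0)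
    (h1 : lineInvariant o z = lineInvariant o z') (h2 : lineInvariant o' z = lineInvariant o' z') :
    z = z' := by
  rw [← sub_eq_zero]
  refine (mul_eq_zero.1 (?_ : (z - z') * lineInvariant o o' = 0)).resolve_right h
  simp only [lineInvariant] at h1 h2 ⊢
  linear_combination h1 * o' - h2 * o

theorem lineInvariant_intersection {o o' : ℂ} (h : lineInvariant o o' ≠ 0) (x y : ℂ) :
    lineInvariant o ((lineInvariant o x * o' - lineInvariant o' y * o) / lineInvariant o o')
        = lineInvariant o x ∧
    lineInvariant o' ((lineInvariant o x * o' - lineInvariant o' y * o) / lineInvariant o o')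
        = lineInvariant o' y := by
  -- The determinant is purely imaginary, which controls the conjugate of the quotient.
  have hD : conj (lineInvariant o o') = -lineInvariant o o' := by
    simp only [lineInvariant, map_sub, map_mul, Complex.conj_conj]
    ring
  constructor <;>
  · rw [lineInvariant, map_div₀, hD]
    field_simp
    simp only [lineInvariant, map_sub, map_mul, Complex.conj_conj]
    ring

end CycloTomo

namespace CycloTomo

open RealRAM

/-! ### Grids of cyclotomic lines -/

section Grid

variable {n m : ℕ} {ζ : ℂ} {o : Fin m → ℂ}

/-- The data `𝒟` compute with the coordinates of the module lines in the directions `o`. -/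
structure GridData.Models (𝒟 : GridData (Nat.totient n) m) (ζ : ℂ) (o : Fin m → ℂ) : Prop where
  pos : 0 < 𝒟.N
  key : ∀ i v, ofIntCoords n ζ (𝒟.key i v) = lineInvariant (o i) (ofIntCoords n ζ v)
  point : ∀ x y, ofIntCoords n ζ (𝒟.A x + 𝒟.B y) / 𝒟.N =
    (lineInvariant (o 𝒟.i₀) (ofIntCoords n ζ x) * o 𝒟.i₁ -
      lineInvariant (o 𝒟.i₁) (ofIntCoords n ζ y) * o 𝒟.i₀) / lineInvariant (o 𝒟.i₀) (o 𝒟.i₁)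

/-- Multiplying numerator and denominator of Cramer's formula by the cofactor `E` replaces the
determinant by `N` and leaves numerators in ℤ[ζ] that are additive in each line. -/
theorem exists_models (hn : 0 < n) (hζ : IsPrimitiveRoot ζ n) (ho : ∀ i, o i ∈ moduleO ζ)
    {i₀ i₁ : Fin m} (h : lineInvariant (o i₀) (o i₁) ≠ 0) :
    ∃ 𝒟 : GridData (Nat.totient n) m, 𝒟.Models ζ o ∧ 𝒟.i₀ = i₀ ∧ 𝒟.i₁ = i₁ := by
  obtain ⟨E, hE, N, hN, hDE⟩ :=
    exists_mul_eq_natCast hn hζ (lineInvariant_mem hn hζ (ho i₀) (ho i₁)) h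
  choose key hkey using fun i => exists_linearMap_of_additive hn hζ (lineInvariant (o i))
    (lineInvariant_add _) fun z hz => lineInvariant_mem hn hζ (ho i) hz
  obtain ⟨A, hA⟩ := exists_linearMap_of_additive hn hζ
    (fun z => E * (lineInvariant (o i₀) z * o i₁))
    (fun x y => by rw [lineInvariant_add]; ring)
    fun z hz => mul_mem hE (mul_mem (lineInvariant_mem hn hζ (ho i₀) hz) (ho i₁))
  obtain ⟨B, hB⟩ := exists_linearMap_of_additive hn hζ
    (fun z => -(E * (lineInvariant (o i₁) z * o i₀)))
    (fun x y => by rw [lineInvariant_add]; ring)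
    fun z hz => neg_mem (mul_mem hE (mul_mem (lineInvariant_mem hn hζ (ho i₁) hz) (ho i₀)))
  refine ⟨⟨N, key, A, B, i₀, i₁⟩, ⟨hN, hkey, fun x y => ?_⟩, rfl, rfl⟩
  have hN' : (N : ℂ) ≠ 0 := by exact_mod_cast hN.ne'
  rw [map_add, hA, hB, div_eq_div_iff hN' h, ← hDE]
  ring

theorem Entry.line_eq (i : Fin m) (e : Entry n) :
    (Entry.line ζ (o i) e).1 = lineSet (ofIntCoords n ζ e.1) (o i) := by
  rw [← ofCoords_intCast]
  rfl

theorem mem_grid_iff {p : (i : Fin m) → Line (o i) → ℕ} {L : Fin m → List (Entry n)}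
    (hL : ∀ i, Represents ζ (p i) (L i)) (ho : ∀ i, o i ≠ 0) {z : ℂ} :
    z ∈ grid p ↔ ∀ i, ∃ e ∈ L i,
      lineInvariant (o i) z = lineInvariant (o i) (ofIntCoords n ζ e.1) := by
  simp only [grid, Set.mem_iInter, Set.mem_iUnion, exists_prop]
  refine forall_congr' fun i => ?_
  constructor
  · rintro ⟨ℓ, hℓ, hz⟩
    obtain ⟨e, he, rfl⟩ := ((hL i).2.2 ℓ).1 hℓ
    rw [Entry.line_eq, mem_lineSet_iff (ho i)] at hz
    exact ⟨e, he, hz⟩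
  · rintro ⟨e, he, hz⟩
    refine ⟨_, ((hL i).2.2 _).2 ⟨e, he, rfl⟩, ?_⟩
    rwa [Entry.line_eq, mem_lineSet_iff (ho i)]

theorem pairwise_lineInvariant_ne {i : Fin m} {p : Line (o i) → ℕ} {l : List (Entry n)}
    (hl : Represents ζ p l) (ho : o i ≠ 0) :
    l.Pairwise fun e e' => lineInvariant (o i) (ofIntCoords n ζ e.1) ≠
      lineInvariant (o i) (ofIntCoords n ζ e'.1) := by
  refine (List.pairwise_map.1 hl.1).imp fun {e e'} h h' => h (Subtype.ext ?_)
  rwa [Entry.line_eq, Entry.line_eq, lineSet_eq_iff ho]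

theorem length_le_maxSupport {p : (i : Fin m) → Line (o i) → ℕ} {L : Fin m → List (Entry n)}
    (hL : ∀ i, Represents ζ (p i) (L i)) (i : Fin m) : (L i).length ≤ maxSupport p := by
  classical
  have h : Function.support (p i) = ((L i).map (Entry.line ζ (o i))).toFinset := by
    ext ℓ
    rw [(hL i).2.2 ℓ]
    simp
  have h' : (L i).length = (Function.support (p i)).ncard := by
    rw [h, Set.ncard_coe_finset, List.toFinset_card_of_nodup (hL i).1, List.length_map]
  rw [h']
  exact Finset.le_sup (f := fun i => (Function.support (p i)).ncard) (Finset.mem_univ i)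

namespace GridData.Models

variable {𝒟 : GridData (Nat.totient n) m} {p : (i : Fin m) → Line (o i) → ℕ}
  {L : Fin m → List (Entry n)}

theorem lineInvariant_point (h𝒟 : 𝒟.Models ζ o)
    (h : lineInvariant (o 𝒟.i₀) (o 𝒟.i₁) ≠ 0) (x y : Fin (Nat.totient n) → ℤ) :
    lineInvariant (o 𝒟.i₀) (ofIntCoords n ζ (𝒟.A x + 𝒟.B y) / 𝒟.N) =
        lineInvariant (o 𝒟.i₀) (ofIntCoords n ζ x) ∧
      lineInvariant (o 𝒟.i₁) (ofIntCoords n ζ (𝒟.A x + 𝒟.B y) / 𝒟.N) =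
        lineInvariant (o 𝒟.i₁) (ofIntCoords n ζ y) := by
  rw [h𝒟.point]
  exact lineInvariant_intersection h _ _

theorem accepts_iff (h𝒟 : 𝒟.Models ζ o) (hn : 0 < n) (hζ : IsPrimitiveRoot ζ n)
    (hL : ∀ i, Represents ζ (p i) (L i)) (ho : ∀ i, o i ≠ 0) (v w : Fin (Nat.totient n) → ℤ) :
    𝒟.Accepts L v w ↔ ofIntCoords n ζ w / 𝒟.N ∈ grid p ∧
      ofIntCoords n ζ w / 𝒟.N - ofIntCoords n ζ v / 𝒟.N ∈ moduleO ζ := by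
  have hN : (𝒟.N : ℂ) ≠ 0 := by exact_mod_cast h𝒟.pos.ne'
  refine and_congr ?_ ?_
  · rw [mem_grid_iff hL ho]
    refine forall_congr' fun i => exists_congr fun e => and_congr_right fun _ => ?_
    rw [← (ofIntCoords_injective hn hζ).eq_iff, map_smul, h𝒟.key, h𝒟.key, div_eq_mul_inv]
    have := lineInvariant_mul_real (o i) (ofIntCoords n ζ w) (𝒟.N : ℝ)⁻¹
    push_cast at this
    rw [this, ← div_eq_mul_inv, div_eq_iff hN, eq_comm, zsmul_eq_mul, mul_comm]
    simp
  · rw [← ofCoords_mem_moduleO_iff hn hζ (fun k => ((w k - v k : ℤ) : ℚ) * (1 / 𝒟.N)),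
      ← sub_div, ← map_sub]
    have := ofCoords_mul (ζ := ζ) (w - v) (1 / 𝒟.N)
    simp only [Pi.sub_apply] at this
    rw [this]
    simp [div_eq_mul_inv]

theorem mem_points_iff (𝒟 : GridData (Nat.totient n) m) {v : Fin (Nat.totient n) → ℤ}
    {q : Fin (Nat.totient n) → ℚ} :
    q ∈ 𝒟.points L v ↔ ∃ x ∈ L 𝒟.i₀, ∃ y ∈ L 𝒟.i₁, 𝒟.Accepts L v (𝒟.A x.1 + 𝒟.B y.1) ∧
      q = fun k => ((𝒟.A x.1 + 𝒟.B y.1) k : ℚ) * (1 / 𝒟.N) := by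
  classical
  simp only [GridData.points, List.mem_flatMap]
  refine exists_congr fun x => and_congr_right fun _ => exists_congr fun y =>
    and_congr_right fun _ => ?_
  split_ifs with h <;> simp [h]

theorem ofCoords_div (𝒟 : GridData (Nat.totient n) m) (w : Fin (Nat.totient n) → ℤ) :
    ofCoords ζ (fun k => (w k : ℚ) * (1 / 𝒟.N)) = ofIntCoords n ζ w / 𝒟.N := by
  rw [ofCoords_mul]
  simp [div_eq_mul_inv]

theorem mem_pointSet_points (h𝒟 : 𝒟.Models ζ o) (hn : 0 < n) (hζ : IsPrimitiveRoot ζ n)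
    (hL : ∀ i, Represents ζ (p i) (L i)) (ho : ∀ i, o i ≠ 0)
    (h : lineInvariant (o 𝒟.i₀) (o 𝒟.i₁) ≠ 0) {v : Fin (Nat.totient n) → ℤ} {z : ℂ} :
    z ∈ pointSet ζ (𝒟.points L v) ↔ z ∈ grid p ∧ z - ofIntCoords n ζ v / 𝒟.N ∈ moduleO ζ := by
  constructor
  · rintro ⟨q, hq, rfl⟩
    obtain ⟨x, -, y, -, hxy, rfl⟩ := (mem_points_iff 𝒟).1 hq
    rw [h𝒟.accepts_iff hn hζ hL ho] at hxy
    rwa [ofCoords_div]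
  · rintro ⟨hz, hv⟩
    obtain ⟨x, hx, hzx⟩ := (mem_grid_iff hL ho).1 hz 𝒟.i₀
    obtain ⟨y, hy, hzy⟩ := (mem_grid_iff hL ho).1 hz 𝒟.i₁
    obtain ⟨h1, h2⟩ := h𝒟.lineInvariant_point h x.1 y.1
    obtain rfl := eq_of_lineInvariant_eq h (hzx.trans h1.symm) (hzy.trans h2.symm)
    exact ⟨_, (mem_points_iff 𝒟).2 ⟨x, hx, y, hy,
      (h𝒟.accepts_iff hn hζ hL ho _ _).2 ⟨hz, hv⟩, rfl⟩, ofCoords_div 𝒟 _⟩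

/-- A point determines the line of each direction through it, so it arises from a single pair of
entries and no duplicates need to be removed. -/
theorem nodup_points (h𝒟 : 𝒟.Models ζ o) (hL : ∀ i, Represents ζ (p i) (L i))
    (ho : ∀ i, o i ≠ 0) (h : lineInvariant (o 𝒟.i₀) (o 𝒟.i₁) ≠ 0)
    (v : Fin (Nat.totient n) → ℤ) : (𝒟.points L v).Nodup := by
  classical
  have key : ∀ x y x' y' : Entry n,
      (fun k => ((𝒟.A x.1 + 𝒟.B y.1) k : ℚ) * (1 / 𝒟.N)) =
        (fun k => ((𝒟.A x'.1 + 𝒟.B y'.1) k : ℚ) * (1 / 𝒟.N)) →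
      lineInvariant (o 𝒟.i₀) (ofIntCoords n ζ x.1) =
        lineInvariant (o 𝒟.i₀) (ofIntCoords n ζ x'.1) ∧
      lineInvariant (o 𝒟.i₁) (ofIntCoords n ζ y.1) =
        lineInvariant (o 𝒟.i₁) (ofIntCoords n ζ y'.1) := by
    intro x y x' y' hxy
    have := congrArg (ofCoords ζ) hxy
    rw [ofCoords_div, ofCoords_div] at this
    rw [← (h𝒟.lineInvariant_point h x.1 y.1).1, ← (h𝒟.lineInvariant_point h x.1 y.1).2,
      ← (h𝒟.lineInvariant_point h x'.1 y'.1).1, ← (h𝒟.lineInvariant_point h x'.1 y'.1).2, this]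
    exact ⟨rfl, rfl⟩
  rw [GridData.points, List.nodup_flatMap]
  refine ⟨fun x _ => ?_, (pairwise_lineInvariant_ne (hL _) (ho _)).imp fun {x x'} hxx' => ?_⟩
  · rw [List.nodup_flatMap]
    refine ⟨fun y _ => by split_ifs <;> simp,
      (pairwise_lineInvariant_ne (hL _) (ho _)).imp fun {y y'} hyy' => ?_⟩
    intro q hq hq'
    beta_reduce at hq hq'
    split_ifs at hq hq' <;> simp only [List.mem_singleton, List.not_mem_nil] at hq hq'
    exact hyy' (key x y x y' (hq.symm.trans hq')).2
  · intro q hq hq'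
    obtain ⟨y, -, hq⟩ := List.mem_flatMap.1 hq
    obtain ⟨y', -, hq'⟩ := List.mem_flatMap.1 hq'
    split_ifs at hq hq' <;> simp only [List.mem_singleton, List.not_mem_nil] at hq hq'
    exact hxx' (key x y x' y' (hq.symm.trans hq')).1

end GridData.Models

/-! ### Residues modulo N and correctness of the partition -/

/-- The vectors with coordinates in `{0, …, N - 1}`. -/
noncomputable def residues (d N : ℕ) : List (Fin d → ℤ) :=
  (Finset.univ : Finset (Fin d → Fin N)).toList.map fun f k => ((f k : ℕ) : ℤ)

theorem mem_residues {d N : ℕ} {v : Fin d → ℤ} : v ∈ residues d N ↔ ∀ k, 0 ≤ v k ∧ v k < N := by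
  simp only [residues, List.mem_map, Finset.mem_toList, Finset.mem_univ, true_and]
  constructor
  · rintro ⟨f, rfl⟩ k
    exact ⟨by positivity, Int.ofNat_lt.2 (f k).2⟩
  · intro h
    refine ⟨fun k => ⟨(v k).toNat, ?_⟩, ?_⟩
    · have := h k
      omega
    · funext k
      exact Int.toNat_of_nonneg (h k).1

theorem nodup_residues (d N : ℕ) : (residues d N).Nodup := by
  refine (Finset.nodup_toList _).map fun f g h => ?_
  funext k
  exact Fin.ext (by exact_mod_cast congrFun h k)

theorem sub_mem_moduleO_iff (hn : 0 < n) (hζ : IsPrimitiveRoot ζ n) {N : ℕ} (hN : 0 < N)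
    (v w : Fin (Nat.totient n) → ℤ) :
    ofIntCoords n ζ w / N - ofIntCoords n ζ v / N ∈ moduleO ζ ↔ ∀ k, (N : ℤ) ∣ w k - v k := by
  have hN' : (N : ℚ) ≠ 0 := by exact_mod_cast hN.ne'
  have h := ofCoords_mul (ζ := ζ) (w - v) (1 / N)
  rw [← sub_div, ← map_sub, div_eq_mul_one_div]
  push_cast at h
  rw [← h, ofCoords_mem_moduleO_iff hn hζ]
  refine forall_congr' fun k => exists_congr fun z => ?_
  rw [mul_one_div, div_eq_iff hN', Pi.sub_apply, mul_comm]
  exact_mod_cast Iff.rfl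

theorem GridData.Models.listsFamily {𝒟 : GridData (Nat.totient n) m}
    {p : (i : Fin m) → Line (o i) → ℕ} {L : Fin m → List (Entry n)} (h𝒟 : 𝒟.Models ζ o)
    (hn : 0 < n) (hζ : IsPrimitiveRoot ζ n) (hL : ∀ i, Represents ζ (p i) (L i))
    (ho : ∀ i, o i ≠ 0) (h : lineInvariant (o 𝒟.i₀) (o 𝒟.i₁) ≠ 0) :
    ListsFamily ζ (classesIn ζ (grid p)) (𝒟.classes L (residues _ 𝒟.N)) := by
  classical
  have hmem := fun v z => h𝒟.mem_pointSet_points hn hζ hL ho h (v := v) (z := z)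
  have hne : ∀ v, 𝒟.points L v ≠ [] ↔ ∃ z, z ∈ pointSet ζ (𝒟.points L v) := by
    intro v
    refine ⟨fun hv => ?_, fun ⟨_, q, hq, _⟩ => List.ne_nil_of_mem hq⟩
    obtain ⟨q, hq⟩ := List.exists_mem_of_ne_nil _ hv
    exact ⟨_, q, hq, rfl⟩
  have hclasses : 𝒟.classes L (residues _ 𝒟.N) =
      ((residues _ 𝒟.N).filter fun v => 𝒟.points L v ≠ []).map (𝒟.points L) := by
    rw [GridData.classes, List.filter_map]
    congr
  have hset : ∀ v x, x ∈ grid p → x - ofIntCoords n ζ v / 𝒟.N ∈ moduleO ζ →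
      pointSet ζ (𝒟.points L v) = {y | y ∈ grid p ∧ ModEquiv ζ x y} := by
    intro v x hx hxv
    ext y
    rw [hmem]
    refine and_congr_right fun _ => ?_
    rw [ModEquiv, ← sub_sub_sub_cancel_right x y (ofIntCoords n ζ v / 𝒟.N)]
    exact ⟨fun hy => sub_mem hxv hy, fun hy => by simpa using sub_mem hxv hy⟩
  rw [hclasses]
  refine ⟨?_, ?_, ?_⟩
  · intro l hl
    obtain ⟨v, -, rfl⟩ := List.mem_map.1 hl
    exact h𝒟.nodup_points hL ho h v
  · rw [List.map_map]
    -- The classes kept are nonempty. A common point forces two residues to be congruent modulo `N`,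
    -- hence equal.
    refine List.Nodup.map_on ?_ ((nodup_residues _ _).filter _)
    intro v hv w hw hvw
    rw [List.mem_filter] at hv hw
    obtain ⟨z, hz⟩ := (hne v).1 (by simpa using hv.2)
    have hz' : z ∈ pointSet ζ (𝒟.points L w) := by
      have : pointSet ζ (𝒟.points L v) = pointSet ζ (𝒟.points L w) := hvw
      rwa [← this]
    have hd := sub_mem ((hmem v z).1 hz).2 ((hmem w z).1 hz').2
    rw [sub_sub_sub_cancel_left, sub_mem_moduleO_iff hn hζ h𝒟.pos] at hd
    funext k
    have h1 := mem_residues.1 hv.1 k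
    have h2 := mem_residues.1 hw.1 k
    rw [← Int.emod_eq_of_lt h1.1 h1.2, ← Int.emod_eq_of_lt h2.1 h2.2]
    exact (Int.emod_eq_emod_iff_emod_sub_eq_zero.2 (Int.emod_eq_zero_of_dvd (hd k))).symm
  · intro A
    simp only [List.map_map, List.mem_map, List.mem_filter, decide_eq_true_eq, Function.comp_apply]
    constructor
    · rintro ⟨x, hx, rfl⟩
      obtain ⟨e, -, he⟩ := (mem_grid_iff hL ho).1 hx 𝒟.i₀
      obtain ⟨e', -, he'⟩ := (mem_grid_iff hL ho).1 hx 𝒟.i₁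
      obtain ⟨h1, h2⟩ := h𝒟.lineInvariant_point h e.1 e'.1
      set w := 𝒟.A e.1 + 𝒟.B e'.1
      have hxw : x = ofIntCoords n ζ w / 𝒟.N :=
        eq_of_lineInvariant_eq h (he.trans h1.symm) (he'.trans h2.symm)
      have hN : (0 : ℤ) < 𝒟.N := by exact_mod_cast h𝒟.pos
      -- The residue representing the class of x is obtained by reducing the coordinates of N·x
      -- modulo `N`.
      have hxv : x - ofIntCoords n ζ (fun k => w k % 𝒟.N) / 𝒟.N ∈ moduleO ζ := by
        rw [hxw, sub_mem_moduleO_iff hn hζ h𝒟.pos]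
        exact fun k => Int.dvd_self_sub_emod
      refine ⟨fun k => w k % 𝒟.N, ⟨mem_residues.2 fun k =>
        ⟨Int.emod_nonneg _ hN.ne', Int.emod_lt_of_pos _ hN⟩, (hne _).2 ⟨x, ?_⟩⟩, hset _ x hx hxv⟩
      exact (hmem _ x).2 ⟨hx, hxv⟩
    · rintro ⟨v, ⟨-, hv⟩, rfl⟩
      obtain ⟨x, hx⟩ := (hne v).1 hv
      obtain ⟨hx, hxv⟩ := (hmem v x).1 hx
      exact ⟨x, hx, hset v x hx hxv⟩

theorem encodeInput_eq (L : Fin m → List (Entry n)) :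
    encodeInput L = ((List.finRange m).flatMap fun i => GridData.listInput (L i)).map
      fun z : ℤ => (z : ℝ) := by
  simp [encodeInput, GridData.listInput, GridData.entryInput, List.ofFn_eq_map, List.flatMap_def,
    List.map_flatten, Function.comp_def]

theorem encodeOutput_eq (Q : List (List (Fin (Nat.totient n) → ℚ))) :
    encodeOutput Q = (GridData.tape Q).map fun q : ℚ => (q : ℝ) := by
  simp [encodeOutput, GridData.tape, List.ofFn_eq_map, List.flatMap_def,
    List.map_flatten, Function.comp_def]

end Grid

end CycloTomo

/-! ### The main theorem -/

theorem theorem1 (n : ℕ) (hn : 3 ≤ n) (ζ : ℂ) (hζ : IsPrimitiveRoot ζ n)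
    (m : ℕ) (hm : 2 ≤ m) (o : Fin m → ℂ)
    (ho : ∀ i, o i ∈ CycloTomo.moduleO ζ ∧ o i ≠ 0)
    (hpar : Pairwise fun i j => LinearIndependent ℝ ![o i, o j]) :
    (∀ q : Fin (Nat.totient n) → ℚ,
      CycloTomo.ofCoords ζ q ∈ CycloTomo.moduleO ζ ↔ ∀ k, ∃ z : ℤ, q k = (z : ℚ)) ∧
    ∃ (P : RealRAM.Program) (C : ℕ),
      ∀ p : (i : Fin m) → CycloTomo.Line (o i) → ℕ,
        (∀ i, (Function.support (p i)).Finite) →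
        (∀ i, Function.support (p i) ⊆ CycloTomo.moduleLines ζ (o i)) →
        ∀ L : Fin m → List (CycloTomo.Entry n),
          (∀ i, CycloTomo.Represents ζ (p i) (L i)) →
          ∃ (t : ℕ) (Q : List (List (Fin (Nat.totient n) → ℚ))),
            t ≤ C * (CycloTomo.maxSupport p ^ 2 + 1) ∧
            RealRAM.HaltsWith P (CycloTomo.encodeInput L) t (CycloTomo.encodeOutput Q) ∧
            CycloTomo.ListsFamily ζ (CycloTomo.classesIn ζ (CycloTomo.grid p)) Q := by
  have hn0 : 0 < n := by omega
  refine ⟨CycloTomo.ofCoords_mem_moduleO_iff hn0 hζ, ?_⟩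
  have h01 := CycloTomo.lineInvariant_ne_zero
    (hpar (i := ⟨0, by omega⟩) (j := ⟨1, by omega⟩) (by simp))
  obtain ⟨𝒟, h𝒟, h0, h1⟩ := CycloTomo.exists_models hn0 hζ (fun i => (ho i).1) h01
  rw [← h0, ← h1] at h01
  obtain ⟨K, hK⟩ := 𝒟.costBound_program (CycloTomo.residues _ 𝒟.N)
  refine ⟨(𝒟.program (CycloTomo.residues _ 𝒟.N)).toProgram, 2 * K, fun p _ _ L hL => ?_⟩
  obtain ⟨t, ht, hP⟩ := RealRAM.Stmt.haltsWith_toProgram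
    (𝒟.wp_program (CycloTomo.length_le_maxSupport hL) (CycloTomo.residues _ 𝒟.N))
  refine ⟨t, 𝒟.classes L (CycloTomo.residues _ 𝒟.N), ?_, ?_,
    h𝒟.listsFamily hn0 hζ hL (fun i => (ho i).2) h01⟩
  · refine (ht.trans (hK _)).trans ?_
    -- The difference of the two sides is (s − 1)²; this is the source of the factor 2 in the
    -- constant `2 * K`.
    have : (CycloTomo.maxSupport p + 1) ^ 2 ≤ 2 * (CycloTomo.maxSupport p ^ 2 + 1) := by
      zify
      nlinarith [sq_nonneg ((CycloTomo.maxSupport p : ℤ) - 1)]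
    calc _ ≤ K * (2 * (CycloTomo.maxSupport p ^ 2 + 1)) := Nat.mul_le_mul_left _ this
      _ = _ := by ring
  · rw [CycloTomo.encodeInput_eq, CycloTomo.encodeOutput_eq]
    exact hP
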